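/- Let $d\geq 2$ be an integer, let $\mathcal{E}$ be a weakly idempotent complete exact category (in the sense of Quillen; weakly idempotent complete means that every split epimorphism has a kernel), and let $\mathcal{M}$ be a $d$-cluster tilting subcategory of $\mathcal{E}$. That is, $\mathcal{M}$ is a full subcategory such that: for every $E\in\mathcal{E}$ there are a deflation $M\to E$ and an inflation $E\to M'$ with $M,M'\in\mathcal{M}$; every $E\in\mathcal{E}$ has a right and a left $\mathcal{M}$-approximation; and $$\mathcal{M}=\{E\in\mathcal{E}\mid \operatorname{Ext}^i_{\mathcal{E}}(E,\mathcal{M})=0 \text{ for all } 0<i<d\}=\{E\in\mathcal{E}\mid \operatorname{Ext}^i_{\mathcal{E}}(\mathcal{M},E)=0 \text{ for all } 0<i<d\},$$ where $\operatorname{Ext}^i_{\mathcal{E}}(X,Y)=\operatorname{Hom}_{D^b(\mathcal{E})}(X,Y[i])$ is the Yoneda Ext-group. For integers $m,n>0$ put $$\mathcal{E}_{m,n}=\{E\in\mathcal{E}\mid \operatorname{Ext}^i_{\mathcal{E}}(E,\mathcal{M})=0=\operatorname{Ext}^j_{\mathcal{E}}(\mathcal{M},E)\text{ for all }0<i<m\text{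 and }0<j<n\}.$$ For a class $\mathcal{S}$ of objects let $\operatorname{Filt}(\mathcal{S})$ consist of the objects $X$ for which there is a finite sequence of inflations $0=X^0\to X^1\to\cdots\to X^k\to X^{k+1}=X$ such that the cokernel of $X^i\to X^{i+1}$ lies in $\mathcal{S}$ for all $0\leq i\leq k$. Then for every $E\in\mathcal{E}$ there exists $M\in\mathcal{M}$ such that $$E\oplus M\in\operatorname{Filt}\Big(\bigcup_{\substack{m,n>0\\ m+n=d}}\mathcal{E}_{m,n}\Big).$$ -/

import Mathlib

open CategoryTheory Limits Pretriangulated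

universe v u

/-- A conflation category structure: an isomorphism-closed class of kernel-cokernel pairs. -/
structure ConflationStructure (C : Type u) [Category.{v} C] [Preadditive C] where
  /-- the conflations `0 ⟶ X₁ ⟶ X₂ ⟶ X₃ ⟶ 0` -/
  conflation : ObjectProperty (ShortComplex C)
  conflation_of_iso {S T : ShortComplex C} (e : S ≅ T) (hS : conflation S) : conflation T
  isKernel {S : ShortComplex C} (hS : conflation S) :
    Nonempty (IsLimit (KernelFork.ofι S.f S.zero))
  isCokernel {S : ShortComplex C} (hS : conflation S) :
    Nonempty (IsColimit (CokernelCofork.ofπ S.g S.zero))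

namespace ConflationStructure

variable {C : Type u} [Category.{v} C] [Preadditive C] (E : ConflationStructure C)

/-- Inflations are the kernel parts of conflations. -/
def inflation : MorphismProperty C := fun _ Y i =>
  ∃ (Z : C) (p : Y ⟶ Z) (w : i ≫ p = 0), E.conflation (ShortComplex.mk i p w)

/-- Deflations are the cokernel parts of conflations. -/
def deflation : MorphismProperty C := fun Y _ p =>
  ∃ (X : C) (i : X ⟶ Y) (w : i ≫ p = 0), E.conflation (ShortComplex.mk i p w)

end ConflationStructure

/-- An exact structure in the sense of Quillen. -/
structure ExactStructure (C : Type u) [Category.{v} C] [Preadditive C] extends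
    ConflationStructure C where
  inflation_id (X : C) : toConflationStructure.inflation (𝟙 X)
  deflation_id (X : C) : toConflationStructure.deflation (𝟙 X)
  inflation_comp {X Y Z : C} (f : X ⟶ Y) (g : Y ⟶ Z) (hf : toConflationStructure.inflation f)
    (hg : toConflationStructure.inflation g) : toConflationStructure.inflation (f ≫ g)
  deflation_comp {X Y Z : C} (f : X ⟶ Y) (g : Y ⟶ Z) (hf : toConflationStructure.deflation f)
    (hg : toConflationStructure.deflation g) : toConflationStructure.deflation (f ≫ g)
  exists_pullback {X Y Z : C} (p : X ⟶ Z) (f : Y ⟶ Z) (hp : toConflationStructure.deflation p) :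
    ∃ (P : C) (f' : P ⟶ X) (p' : P ⟶ Y),
      IsPullback f' p' p f ∧ toConflationStructure.deflation p'
  exists_pushout {X Y Z : C} (i : X ⟶ Y) (f : X ⟶ Z) (hi : toConflationStructure.inflation i) :
    ∃ (P : C) (f' : Y ⟶ P) (i' : Z ⟶ P),
      IsPushout i f f' i' ∧ toConflationStructure.inflation i'

/-- An additive category is weakly idempotent complete if every split epimorphism has a kernel. -/
def IsWeaklyIdempotentComplete (C : Type u) [Category.{v} C] [Preadditive C] : Prop :=
  ∀ ⦃X Y : C⦄ (r : X ⟶ Y), IsSplitEpi r → HasKernel r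

/-! ### The bounded homotopy category -/

namespace BoundedHomotopy

open scoped ZeroObject

variable (C : Type u) [Category.{v} C] [Preadditive C]

/-- The bounded cochain complexes. -/
def boundedComplex : ObjectProperty (CochainComplex C ℤ) :=
  fun K => ∃ a b : ℤ, K.IsStrictlyGE a ∧ K.IsStrictlyLE b

/-- The objects of the homotopy category which are given by bounded complexes. -/
def bounded : ObjectProperty (HomotopyCategory C (ComplexShape.up ℤ)) :=
  (boundedComplex C).strictMap (HomotopyCategory.quotient _ _)

variable {C} in
lemma bounded_quotient_obj_iff (K : CochainComplex C ℤ) :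
    bounded C ((HomotopyCategory.quotient _ _).obj K) ↔ boundedComplex C K := by
  refine ⟨?_, fun h => ⟨_, h⟩⟩
  simp only [bounded, ObjectProperty.strictMap_iff]
  rintro ⟨L, h, hL⟩
  obtain rfl : L = K := congr_arg Quotient.as hL
  exact h

lemma boundedComplex_mappingCone [HasBinaryBiproducts C] {K L : CochainComplex C ℤ} (f : K ⟶ L)
    (hK : boundedComplex C K) (hL : boundedComplex C L) :
    boundedComplex C (CochainComplex.mappingCone f) := by
  obtain ⟨a, b, _, _⟩ := hK
  obtain ⟨a', b', _, _⟩ := hL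
  refine ⟨min (a - 1) a', max (b - 1) b', ?_, ?_⟩
  · rw [CochainComplex.isStrictlyGE_iff]
    intro i hi
    rw [CochainComplex.mappingCone.isZero_X_iff]
    exact ⟨K.isZero_of_isStrictlyGE a _ (by grind), L.isZero_of_isStrictlyGE a' _ (by grind)⟩
  · rw [CochainComplex.isStrictlyLE_iff]
    intro i hi
    rw [CochainComplex.mappingCone.isZero_X_iff]
    exact ⟨K.isZero_of_isStrictlyLE b _ (by grind), L.isZero_of_isStrictlyLE b' _ (by grind)⟩

variable [HasZeroObject C]

lemma bounded_singleFunctor_obj (n : ℤ) (X : C) :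
    bounded C ((HomotopyCategory.singleFunctor C n).obj X) := by
  change bounded C ((HomotopyCategory.quotient _ _).obj ((CochainComplex.singleFunctor C n).obj X))
  rw [bounded_quotient_obj_iff]
  exact ⟨n, n, inferInstance, inferInstance⟩

instance : (bounded C).ContainsZero where
  exists_zero :=
    ⟨(HomotopyCategory.quotient _ _).obj 0, Functor.map_isZero _ (isZero_zero _), by
      rw [bounded_quotient_obj_iff]
      exact ⟨0, 0, inferInstance, inferInstance⟩⟩

instance : (bounded C).IsStableUnderShift ℤ where
  isStableUnderShiftBy n :=
    { le_shift := fun K hK => by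
        obtain ⟨K, rfl⟩ := K.quotient_obj_surjective
        rw [bounded_quotient_obj_iff] at hK
        obtain ⟨a, b, _, _⟩ := hK
        rw [ObjectProperty.prop_shift_iff, HomotopyCategory.shift_quotient_obj,
          bounded_quotient_obj_iff]
        exact ⟨a - n, b - n, CochainComplex.isStrictlyGE_shift K a n (a - n) (by lia),
          CochainComplex.isStrictlyLE_shift K b n (b - n) (by lia)⟩ }

variable [HasBinaryBiproducts C]

instance : (bounded C).IsTriangulatedClosed₃ where
  ext₃' T hT h₁ h₂ := by
    obtain ⟨f : T.obj₁.as ⟶ T.obj₂.as, hf⟩ :=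
      (HomotopyCategory.quotient _ _).map_surjective T.mor₁
    refine ⟨(HomotopyCategory.quotient _ _).obj (CochainComplex.mappingCone f), ?_,
      ⟨Triangle.π₃.mapIso (isoTriangleOfIso₁₂ T _ hT
        (HomotopyCategory.mappingCone_triangleh_distinguished f)
        (Iso.refl _) (Iso.refl _) ?_)⟩⟩
    · rw [bounded_quotient_obj_iff]
      exact boundedComplex_mappingCone C f ((bounded_quotient_obj_iff _).1 h₁)
        ((bounded_quotient_obj_iff _).1 h₂)
    · exact (Category.comp_id _).trans (hf.symm.trans (Category.id_comp _).symm)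

instance : (bounded C).IsTriangulated where
  toIsTriangulatedClosed₂ := .of_isTriangulatedClosed₃

end BoundedHomotopy

/-- The bounded homotopy category of an additive category, with its triangulated structure as a
full subcategory of the homotopy category of all complexes. -/
abbrev BoundedHomotopyCategory (C : Type u) [Category.{v} C] [Preadditive C] :=
  (BoundedHomotopy.bounded C).FullSubcategory

/-- The complex given by `X` in degree `0`, as an object of the bounded homotopy category. -/
noncomputable def BoundedHomotopyCategory.single {C : Type u} [Category.{v} C] [Preadditive C]
    [HasZeroObject C] (X : C) : BoundedHomotopyCategory C :=
  ⟨(HomotopyCategory.singleFunctor C 0).obj X, BoundedHomotopy.bounded_singleFunctor_obj C 0 X⟩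

namespace ExactStructure

variable {C : Type u} [Category.{v} C] [Preadditive C] (E : ExactStructure C)

/-! ### The bounded derived category and Yoneda extensions -/

/-- A complex is acyclic if its differentials factor as `Kⁿ ⟶ Zⁿ⁺¹ ⟶ Kⁿ⁺¹` through conflations
`0 ⟶ Zⁿ ⟶ Kⁿ ⟶ Zⁿ⁺¹ ⟶ 0`. -/
def acyclicComplex : ObjectProperty (CochainComplex C ℤ) := fun K =>
  ∃ (Z : ℤ → C) (i : ∀ n, Z n ⟶ K.X n) (p : ∀ n, K.X n ⟶ Z (n + 1))
    (w : ∀ n, i n ≫ p n = 0),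
    (∀ n, E.conflation (ShortComplex.mk (i n) (p n) (w n))) ∧
      ∀ n, K.d n (n + 1) = p n ≫ i (n + 1)

/-- The objects of the bounded homotopy category which are given by acyclic complexes. -/
def acyclic : ObjectProperty (BoundedHomotopyCategory C) :=
  (E.acyclicComplex.strictMap (HomotopyCategory.quotient _ _)).inverseImage
    (BoundedHomotopy.bounded C).ι

section Ext

variable [HasZeroObject C] [HasBinaryBiproducts C]

/-- The bounded derived category: the Verdier quotient of the bounded homotopy category by the
acyclic complexes, i.e. its localization at the morphisms whose cone is acyclic. -/
abbrev BoundedDerivedCategory := E.acyclic.trW.Localization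

/-- `Ext^n(X, Y) = Hom(X, Y[n])` in the bounded derived category. -/
def Ext (X Y : C) (n : ℕ) : Type (max u v) :=
  (E.acyclic.trW.Q.obj (BoundedHomotopyCategory.single X) : E.BoundedDerivedCategory) ⟶
    E.acyclic.trW.Q.obj ((BoundedHomotopyCategory.single Y)⟦(n : ℤ)⟧)

/-- `Ext^n(X, Y) = 0`: the group `Ext^n(X, Y)` has only one element. -/
def ExtVanishes (X Y : C) (n : ℕ) : Prop := Subsingleton (E.Ext X Y n)

/-! ### Cluster tilting subcategories -/

variable (M : ObjectProperty C)

/-- `Ext^i(X, M) = 0` for all `0 < i < m` and all objects of the subcategory `M`. -/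
def ExtToVanishes (m : ℕ) (X : C) : Prop :=
  ∀ i : ℕ, 0 < i → i < m → ∀ Y : C, M Y → E.ExtVanishes X Y i

/-- `Ext^j(M, X) = 0` for all `0 < j < n` and all objects of the subcategory `M`. -/
def ExtFromVanishes (n : ℕ) (X : C) : Prop :=
  ∀ j : ℕ, 0 < j → j < n → ∀ Y : C, M Y → E.ExtVanishes Y X j

end Ext

end ExactStructure

/-- `f : N ⟶ X` is a right `M`-approximation of `X`. -/
def IsRightApproximation {C : Type u} [Category.{v} C] (M : ObjectProperty C) {N X : C}
    (f : N ⟶ X) : Prop :=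
  M N ∧ ∀ (N' : C), M N' → ∀ g : N' ⟶ X, ∃ h : N' ⟶ N, h ≫ f = g

/-- `f : X ⟶ N` is a left `M`-approximation of `X`. -/
def IsLeftApproximation {C : Type u} [Category.{v} C] (M : ObjectProperty C) {X N : C}
    (f : X ⟶ N) : Prop :=
  M N ∧ ∀ (N' : C), M N' → ∀ g : X ⟶ N', ∃ h : N ⟶ N', f ≫ h = g

namespace ExactStructure

variable {C : Type u} [Category.{v} C] [Preadditive C] [HasZeroObject C] [HasBinaryBiproducts C]

/-- The full subcategory `M` is `d`-cluster tilting. -/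
structure IsClusterTilting (E : ExactStructure C) (d : ℕ) (M : ObjectProperty C) : Prop where
  generating (X : C) : ∃ (N : C) (p : N ⟶ X), M N ∧ E.deflation p
  cogenerating (X : C) : ∃ (N : C) (i : X ⟶ N), M N ∧ E.inflation i
  contravariantlyFinite (X : C) : ∃ (N : C) (f : N ⟶ X), IsRightApproximation M f
  covariantlyFinite (X : C) : ∃ (N : C) (f : X ⟶ N), IsLeftApproximation M f
  mem_iff_extTo (X : C) : M X ↔ E.ExtToVanishes M d X
  mem_iff_extFrom (X : C) : M X ↔ E.ExtFromVanishes M d X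

/-- The subcategory `E_{m,n}` of the objects `X` such that `Ext^i(X, M) = 0` for `0 < i < m` and
`Ext^j(M, X) = 0` for `0 < j < n`. -/
def extVanishing (E : ExactStructure C) (M : ObjectProperty C) (m n : ℕ) : ObjectProperty C :=
  fun X => E.ExtToVanishes M m X ∧ E.ExtFromVanishes M n X

/-- The objects filtered by a class `S` of objects: there are inflations
`0 = F⁰ ⟶ F¹ ⟶ ⋯ ⟶ Fᵏ ⟶ Fᵏ⁺¹ = X` whose cokernels are in `S`. (The objects `F i` with `i > k + 1`
and the morphisms `f i` with `i > k` are irrelevant.) -/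
def Filt {C : Type u} [Category.{v} C] [Preadditive C] (E : ExactStructure C)
    (S : ObjectProperty C) : ObjectProperty C := fun X =>
  ∃ (k : ℕ) (F : ℕ → C) (f : ∀ i, F i ⟶ F (i + 1)),
    IsZero (F 0) ∧ Nonempty (F (k + 1) ≅ X) ∧
      ∀ i ≤ k, ∃ (Q : C) (p : F (i + 1) ⟶ Q) (w : f i ≫ p = 0),
        E.conflation (ShortComplex.mk (f i) p w) ∧ S Q

end ExactStructure

/-! ### Universal squares from separate existence and uniqueness -/

namespace CategoryTheory

variable {C : Type u} [Category.{v} C]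

/-! Suppose `Ext^j(M, X) = 0` for `0 < j < n`, and let `m + n = d`. The core is a conflation `K → L
→ X` with `Ext^i(L, M) = 0` for `0 < i < m` and `Ext^j(M, K) = 0` for `0 < j < n + 2`
(`exists_isConflation_extVanishing`). As an extension of `X` by `K`, the object `L` also satisfies
`Ext^j(M, L) = 0` for `0 < j < n`, so `L` lies in `E_{m,n}`.

Embed `L` in some `N ∈ M` and let `W` be the cokernel of `K → L → N`. The conflation `K → N → W`
lowers the vanishing range of `K` by one, so `Ext^j(M, W) = 0` for `0 < j < n + 1`: one degree
better than `X`. Also `W` is the pushout of `L → N` along `L → X`, which gives a conflation `L → X ⊕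
N → W`. Hence a filtration of `W ⊕ N'` becomes one of `X ⊕ N ⊕ N'` with `L` as new bottom layer.
Induction (`exists_filtered_biprod`) trades `m` for `n` until `m = 1`, where the object itself is in
`E_{1,d-1}`. It starts at `n = 1`, where nothing is required of `X`.

The homological input is the long exact sequences of `Ext`. With `Ext` defined in a Verdier
quotient, they need two facts: conflations give distinguished triangles
(`IsConflation.exists_distinguished`), and `toDerived` is full. Fullness turns the lifting property
of approximations into vanishing of `Ext^1`. -/

lemma IsPushout.of_exists_desc {X Y Z P : C} {f : X ⟶ Y} {g : X ⟶ Z} {a : Y ⟶ P} {b : Z ⟶ P}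
    (w : f ≫ a = g ≫ b)
    (desc : ∀ (T : C) (s : Y ⟶ T) (t : Z ⟶ T), f ≫ s = g ≫ t → ∃ l : P ⟶ T, a ≫ l = s ∧ b ≫ l = t)
    (ext : ∀ (T : C) (l l' : P ⟶ T), a ≫ l = a ≫ l' → b ≫ l = b ≫ l' → l = l') :
    IsPushout f g a b :=
  ⟨⟨w⟩, ⟨PushoutCocone.IsColimit.mk w
    (fun s => (desc _ s.inl s.inr s.condition).choose)
    (fun s => (desc _ s.inl s.inr s.condition).choose_spec.1)
    (fun s => (desc _ s.inl s.inr s.condition).choose_spec.2)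
    (fun s _ h₁ h₂ => ext _ _ _
      (h₁.trans (desc _ s.inl s.inr s.condition).choose_spec.1.symm)
      (h₂.trans (desc _ s.inl s.inr s.condition).choose_spec.2.symm))⟩⟩

lemma IsPullback.of_exists_lift {X Y Z P : C} {f : X ⟶ Z} {g : Y ⟶ Z} {a : P ⟶ X} {b : P ⟶ Y}
    (w : a ≫ f = b ≫ g)
    (lift : ∀ (T : C) (s : T ⟶ X) (t : T ⟶ Y), s ≫ f = t ≫ g → ∃ l : T ⟶ P, l ≫ a = s ∧ l ≫ b = t)
    (ext : ∀ (T : C) (l l' : T ⟶ P), l ≫ a = l' ≫ a → l ≫ b = l' ≫ b → l = l') :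
    IsPullback a b f g :=
  ⟨⟨w⟩, ⟨PullbackCone.IsLimit.mk w
    (fun s => (lift _ s.fst s.snd s.condition).choose)
    (fun s => (lift _ s.fst s.snd s.condition).choose_spec.1)
    (fun s => (lift _ s.fst s.snd s.condition).choose_spec.2)
    (fun s _ h₁ h₂ => ext _ _ _
      (h₁.trans (lift _ s.fst s.snd s.condition).choose_spec.1.symm)
      (h₂.trans (lift _ s.fst s.snd s.condition).choose_spec.2.symm))⟩⟩

end CategoryTheory

/-! ### Conflations: elementary calculus in an exact category -/

namespace ExactStructure

variable {C : Type u} [Category.{v} C] [Preadditive C] (E : ExactStructure C)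

/-- The morphisms `i` and `p` form a conflation. -/
def IsConflation {X Y Z : C} (i : X ⟶ Y) (p : Y ⟶ Z) : Prop :=
  ∃ w : i ≫ p = 0, E.conflation (ShortComplex.mk i p w)

variable {E}

namespace IsConflation

variable {X Y Z : C} {i : X ⟶ Y} {p : Y ⟶ Z} (h : E.IsConflation i p)
include h

lemma inflation : E.inflation i := ⟨_, p, h.1, h.2⟩

lemma deflation : E.deflation p := ⟨_, i, h.1, h.2⟩

lemma zero : i ≫ p = 0 := h.1

lemma mono : Mono i := by
  obtain ⟨l⟩ := E.isKernel h.2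
  exact ⟨fun a b hab => Fork.IsLimit.hom_ext l hab⟩

lemma epi : Epi p := by
  obtain ⟨l⟩ := E.isCokernel h.2
  exact ⟨fun a b hab => Cofork.IsColimit.hom_ext l hab⟩

lemma exists_lift {T : C} (t : T ⟶ Y) (ht : t ≫ p = 0) : ∃ s : T ⟶ X, s ≫ i = t := by
  obtain ⟨l⟩ := E.isKernel h.2
  obtain ⟨s, hs⟩ := KernelFork.IsLimit.lift' l t ht
  exact ⟨s, hs⟩

lemma exists_desc {T : C} (t : Y ⟶ T) (ht : i ≫ t = 0) : ∃ s : Z ⟶ T, p ≫ s = t := by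
  obtain ⟨l⟩ := E.isCokernel h.2
  obtain ⟨s, hs⟩ := CokernelCofork.IsColimit.desc' l t ht
  exact ⟨s, hs⟩

lemma of_iso {X' Y' Z' : C} {i' : X' ⟶ Y'} {p' : Y' ⟶ Z'} (e₁ : X ≅ X') (e₂ : Y ≅ Y')
    (e₃ : Z ≅ Z') (h₁ : i ≫ e₂.hom = e₁.hom ≫ i') (h₂ : p ≫ e₃.hom = e₂.hom ≫ p') :
    E.IsConflation i' p' := by
  have w : i' ≫ p' = 0 := by
    rw [← cancel_epi e₁.hom, ← reassoc_of% h₁, ← h₂, reassoc_of% h.1]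
    simp
  exact ⟨w, E.conflation_of_iso (ShortComplex.isoMk e₁ e₂ e₃ h₁.symm h₂.symm) h.2⟩

end IsConflation

/-- Kernels are unique up to isomorphism and conflations are closed under isomorphism, so any kernel
of a deflation completes it to a conflation. -/
lemma isConflation_of_deflation {X Y Z : C} {i : X ⟶ Y} {p : Y ⟶ Z} (hp : E.deflation p)
    (w : i ≫ p = 0) (hi : Mono i)
    (lift : ∀ (T : C) (t : T ⟶ Y), t ≫ p = 0 → ∃ s : T ⟶ X, s ≫ i = t) :
    E.IsConflation i p := by
  obtain ⟨X', i', w', h⟩ := hp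
  have h : E.IsConflation i' p := ⟨w', h⟩
  have := h.mono
  obtain ⟨a, ha⟩ := lift _ i' w'
  obtain ⟨b, hb⟩ := h.exists_lift i w
  refine h.of_iso ⟨a, b, ?_, ?_⟩ (Iso.refl _) (Iso.refl _) (by simpa using ha.symm) (by simp)
  · rw [← cancel_mono i']; simp [ha, hb]
  · rw [← cancel_mono i]; simp [ha, hb]

lemma isConflation_of_inflation {X Y Z : C} {i : X ⟶ Y} {p : Y ⟶ Z} (hi : E.inflation i)
    (w : i ≫ p = 0) (hp : Epi p)
    (desc : ∀ (T : C) (t : Y ⟶ T), i ≫ t = 0 → ∃ s : Z ⟶ T, p ≫ s = t) :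
    E.IsConflation i p := by
  obtain ⟨Z', p', w', h⟩ := hi
  have h : E.IsConflation i p' := ⟨w', h⟩
  have := h.epi
  obtain ⟨a, ha⟩ := desc _ p' w'
  obtain ⟨b, hb⟩ := h.exists_desc p w
  refine h.of_iso (Iso.refl _) (Iso.refl _) ⟨b, a, ?_, ?_⟩ (by simp) (by simpa using hb)
  · rw [← cancel_epi p']; simp [reassoc_of% hb, ha]
  · rw [← cancel_epi p]; simp [reassoc_of% ha, hb]

variable (E)

lemma isConflation_id_of_isZero (X : C) {Z : C} (hZ : IsZero Z) (p : X ⟶ Z) :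
    E.IsConflation (𝟙 X) p :=
  isConflation_of_inflation (E.inflation_id X) (hZ.eq_of_tgt _ _)
    ⟨fun _ _ _ => hZ.eq_of_src _ _⟩
    (fun _ _ ht => ⟨0, by simpa using ht.symm⟩)

lemma isConflation_of_isZero_id (X : C) {Z : C} (hZ : IsZero Z) (i : Z ⟶ X) :
    E.IsConflation i (𝟙 X) :=
  isConflation_of_deflation (E.deflation_id X) (hZ.eq_of_src _ _)
    ⟨fun _ _ _ => hZ.eq_of_tgt _ _⟩
    (fun _ _ ht => ⟨0, by simpa using ht.symm⟩)

lemma isConflation_of_isIso_of_isZero {X Y Z : C} (i : X ⟶ Y) [IsIso i] (hZ : IsZero Z)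
    (p : Y ⟶ Z) : E.IsConflation i p :=
  (E.isConflation_id_of_isZero X hZ (i ≫ p)).of_iso (Iso.refl _) (asIso i) (Iso.refl _)
    (by simp) (by simp)

lemma isConflation_of_isZero_of_isIso {X Y Z : C} (p : X ⟶ Y) [IsIso p] (hZ : IsZero Z)
    (i : Z ⟶ X) : E.IsConflation i p :=
  (E.isConflation_of_isZero_id X hZ i).of_iso (Iso.refl _) (Iso.refl _) (asIso p)
    (by simp) (by simp)

variable {E}

lemma isConflation_of_isZero {X Y Z : C} (hX : IsZero X) (hY : IsZero Y) (hZ : IsZero Z)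
    (i : X ⟶ Y) (p : Y ⟶ Z) : E.IsConflation i p := by
  have : IsIso i := ⟨0, hX.eq_of_src _ _, hY.eq_of_src _ _⟩
  exact E.isConflation_of_isIso_of_isZero i hZ p

lemma inflation_of_isIso {X Y : C} (i : X ⟶ Y) [IsIso i] [HasZeroObject C] : E.inflation i :=
  (E.isConflation_of_isIso_of_isZero i (isZero_zero C) 0).inflation

lemma deflation_of_isIso {X Y : C} (i : X ⟶ Y) [IsIso i] [HasZeroObject C] : E.deflation i :=
  (E.isConflation_of_isZero_of_isIso i (isZero_zero C) 0).deflation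

lemma exists_isConflation_of_inflation {X Y : C} {i : X ⟶ Y} (h : E.inflation i) :
    ∃ (Z : C) (p : Y ⟶ Z), E.IsConflation i p := by
  obtain ⟨Z, p, w, h⟩ := h
  exact ⟨Z, p, w, h⟩

lemma exists_isConflation_of_deflation {Y Z : C} {p : Y ⟶ Z} (h : E.deflation p) :
    ∃ (X : C) (i : X ⟶ Y), E.IsConflation i p := by
  obtain ⟨Z, p, w, h⟩ := h
  exact ⟨Z, p, w, h⟩

/-- The pullback of a conflation. -/
lemma IsConflation.exists_isPullback {X Y Z Z' : C} {i : X ⟶ Y} {p : Y ⟶ Z}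
    (h : E.IsConflation i p) (f : Z' ⟶ Z) :
    ∃ (P : C) (i' : X ⟶ P) (p' : P ⟶ Z') (g : P ⟶ Y), E.IsConflation i' p' ∧ i' ≫ g = i ∧
      IsPullback g p' p f := by
  obtain ⟨P, g, p', sq, hp'⟩ := E.exists_pullback p f h.deflation
  have := h.mono
  have hl : sq.lift i 0 (by simp [h.zero]) ≫ g = i := by simp
  refine ⟨P, sq.lift i 0 (by simp [h.zero]), p', g, ?_, by simp, sq⟩
  refine isConflation_of_deflation hp' (by simp) ?_ ?_
  · refine ⟨fun a b hab => ?_⟩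
    rw [← cancel_mono i, ← hl, reassoc_of% hab]
  · intro T t ht
    obtain ⟨s, hs⟩ := h.exists_lift (t ≫ g) (by rw [Category.assoc, sq.w, reassoc_of% ht, zero_comp])
    exact ⟨s, sq.hom_ext (by simp [hs]) (by simp [ht])⟩

/-- The pushout of a conflation. -/
lemma IsConflation.exists_isPushout {X Y Z X' : C} {i : X ⟶ Y} {p : Y ⟶ Z}
    (h : E.IsConflation i p) (f : X ⟶ X') :
    ∃ (P : C) (i' : X' ⟶ P) (p' : P ⟶ Z) (g : Y ⟶ P), E.IsConflation i' p' ∧ g ≫ p' = p ∧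
      IsPushout i f g i' := by
  obtain ⟨P, g, i', sq, hi'⟩ := E.exists_pushout i f h.inflation
  have := h.epi
  have hl : g ≫ sq.desc p 0 (by simp [h.zero]) = p := by simp
  refine ⟨P, i', sq.desc p 0 (by simp [h.zero]), g, ?_, by simp, sq⟩
  refine isConflation_of_inflation hi' (by simp) ?_ ?_
  · refine ⟨fun a b hab => ?_⟩
    rw [← cancel_epi p, ← hl, Category.assoc, Category.assoc, hab]
  · intro T t ht
    obtain ⟨s, hs⟩ := h.exists_desc (g ≫ t) (by rw [sq.w_assoc, ht, comp_zero])
    exact ⟨s, sq.hom_ext (by simp [hs]) (by simp [ht])⟩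

variable [HasZeroObject C]

/-- The axiom provides one pullback with this property; every other one differs from it by an
isomorphism. -/
lemma deflation_of_isPullback {P X Y Z : C} {g : P ⟶ X} {p' : P ⟶ Y} {p : X ⟶ Z} {f : Y ⟶ Z}
    (sq : IsPullback g p' p f) (hp : E.deflation p) : E.deflation p' := by
  obtain ⟨P₀, g₀, p₀, sq₀, h₀⟩ := E.exists_pullback p f hp
  rw [← sq.isoIsPullback_hom_snd _ _ sq₀]
  exact E.deflation_comp _ _ (deflation_of_isIso _) h₀

lemma inflation_of_isPushout {X Y Z P : C} {i : X ⟶ Y} {f : X ⟶ Z} {g : Y ⟶ P} {i' : Z ⟶ P}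
    (sq : IsPushout i f g i') (hi : E.inflation i) : E.inflation i' := by
  obtain ⟨P₀, g₀, i₀, sq₀, h₀⟩ := E.exists_pushout i f hi
  rw [← sq₀.inr_isoIsPushout_hom _ _ sq]
  exact E.inflation_comp _ _ h₀ (inflation_of_isIso _)

/-- If the square is a pushout and `i` is an inflation, the cokernel of `i` is also a cokernel of
the morphism opposite to `i`. -/
lemma IsConflation.of_isPushout {X Y Z W P : C} {i : X ⟶ Y} {q : Y ⟶ W} (h : E.IsConflation i q)
    {f : X ⟶ Z} {g : Y ⟶ P} {i' : Z ⟶ P} (sq : IsPushout i f g i') {q' : P ⟶ W}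
    (hg : g ≫ q' = q) (hi' : i' ≫ q' = 0) : E.IsConflation i' q' := by
  have := h.epi
  refine isConflation_of_inflation (inflation_of_isPushout sq h.inflation) hi'
    ⟨fun a b hab => ?_⟩ (fun T t ht => ?_)
  · rw [← cancel_epi q, ← hg, Category.assoc, Category.assoc, hab]
  · obtain ⟨s, hs⟩ := h.exists_desc (g ≫ t) (by rw [sq.w_assoc, ht, comp_zero])
    exact ⟨s, sq.hom_ext (by simp [reassoc_of% hg, hs]) (by simp [reassoc_of% hi', ht])⟩

section Biprod

variable [HasBinaryBiproducts C] (E)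

open scoped ZeroObject in
lemma isConflation_inl_snd (X Y : C) :
    E.IsConflation (biprod.inl : X ⟶ X ⊞ Y) (biprod.snd : X ⊞ Y ⟶ Y) := by
  have hd : E.deflation (biprod.snd : X ⊞ Y ⟶ Y) := by
    -- The projection is the pullback of the deflation `X ⟶ 0` along `Y ⟶ 0`.
    refine deflation_of_isPullback (IsPullback.of_exists_lift (f := (0 : X ⟶ 0)) (g := (0 : Y ⟶ 0))
      (a := biprod.fst) (by simp) ?_ ?_)
      (E.isConflation_id_of_isZero X (isZero_zero C) 0).deflation
    · intro T s t _
      exact ⟨biprod.lift s t, by simp, by simp⟩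
    · intro T l l' h₁ h₂
      exact biprod.hom_ext _ _ h₁ h₂
  refine isConflation_of_deflation hd (by simp) inferInstance (fun T t ht => ⟨t ≫ biprod.fst, ?_⟩)
  ext <;> simp [ht]

lemma isConflation_inr_fst (X Y : C) :
    E.IsConflation (biprod.inr : Y ⟶ X ⊞ Y) (biprod.fst : X ⊞ Y ⟶ X) :=
  (E.isConflation_inl_snd Y X).of_iso (Iso.refl _) (biprod.braiding _ _) (Iso.refl _)
    (by ext <;> simp) (by simp)

variable {E}

lemma IsConflation.biprod_map_id {X Y Z : C} {i : X ⟶ Y} {p : Y ⟶ Z} (h : E.IsConflation i p)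
    (W : C) : E.IsConflation (i ≫ (biprod.inl : Y ⟶ Y ⊞ W)) (biprod.map p (𝟙 W)) := by
  have := h.mono
  refine isConflation_of_deflation (deflation_of_isPullback (p := p) (f := biprod.fst)
    (g := biprod.fst) (IsPullback.of_exists_lift (by simp) ?_ ?_) h.deflation)
    ?_ inferInstance ?_
  · intro T s t hst
    refine ⟨biprod.lift s (t ≫ biprod.snd), by simp, ?_⟩
    ext <;> simp [hst]
  · intro T l l' h₁ h₂
    refine biprod.hom_ext _ _ h₁ (by simpa using h₂ =≫ biprod.snd)
  · ext <;> simp [h.zero]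
  · intro T t ht
    obtain ⟨s, hs⟩ := h.exists_lift (t ≫ biprod.fst) (by simpa using ht =≫ biprod.fst)
    refine ⟨s, ?_⟩
    ext
    · simp [hs]
    · simpa using (ht =≫ biprod.snd).symm

lemma IsConflation.biprod_id_map {X Y Z : C} {i : X ⟶ Y} {p : Y ⟶ Z} (h : E.IsConflation i p)
    (W : C) : E.IsConflation (i ≫ (biprod.inr : Y ⟶ W ⊞ Y)) (biprod.map (𝟙 W) p) :=
  (h.biprod_map_id W).of_iso (Iso.refl _) (biprod.braiding _ _) (biprod.braiding _ _)
    (by ext <;> simp) (by ext <;> simp)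

lemma inflation_biprod_map_id {X Y : C} {i : X ⟶ Y} (h : E.inflation i) (W : C) :
    E.inflation (biprod.map i (𝟙 W)) := by
  refine inflation_of_isPushout (f := biprod.inl) (g := biprod.inl)
    (IsPushout.of_exists_desc (by simp) ?_ ?_) h
  · intro T s t hst
    refine ⟨biprod.desc s (biprod.inr ≫ t), by simp, ?_⟩
    ext <;> simp [hst]
  · intro T l l' h₁ h₂
    refine biprod.hom_ext' _ _ h₁ (by simpa using biprod.inr ≫= h₂)

/-- Up to a shear automorphism of `Y ⊞ Z`, this is `𝟙 ⊞ p` followed by a projection. It turns an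
approximation into a deflation by adding a deflation from an object of `M`. -/
lemma deflation_biprod_desc {X Y Z : C} {p : X ⟶ Z} (hp : E.deflation p) (f : Y ⟶ Z) :
    E.deflation (biprod.desc f p) := by
  obtain ⟨_, _, h⟩ := exists_isConflation_of_deflation hp
  have : biprod.desc f p = (biprod.map (𝟙 Y) p ≫
      (Biprod.unipotentUpper f : Y ⊞ Z ≅ Y ⊞ Z).hom) ≫ biprod.snd := by
    ext <;> simp
  rw [this]
  exact E.deflation_comp _ _ (E.deflation_comp _ _ (h.biprod_id_map Y).deflation
    (deflation_of_isIso _)) (E.isConflation_inl_snd _ _).deflation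

lemma inflation_biprod_lift {X Y Z : C} {i : X ⟶ Y} (hi : E.inflation i) (f : X ⟶ Z) :
    E.inflation (biprod.lift i f) := by
  have : biprod.lift i f = (biprod.inl ≫
      (Biprod.unipotentUpper f : X ⊞ Z ≅ X ⊞ Z).hom) ≫ biprod.map i (𝟙 Z) := by
    ext <;> simp
  rw [this]
  exact E.inflation_comp _ _ (E.inflation_comp _ _ (E.isConflation_inl_snd _ _).inflation
    (inflation_of_isIso _)) (inflation_biprod_map_id hi Z)

/-- The conflation given by a pushout square of an inflation. -/
lemma isConflation_of_isPushout {X Y Z P : C} {i : X ⟶ Y} {f : X ⟶ Z} {g : Y ⟶ P} {i' : Z ⟶ P}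
    (sq : IsPushout i f g i') (hi : E.inflation i) :
    E.IsConflation (biprod.lift i f) (biprod.desc g (-i')) := by
  refine isConflation_of_inflation (inflation_biprod_lift hi f) (by simp [sq.w])
    ⟨fun a b hab => ?_⟩ (fun T t ht => ?_)
  · exact sq.hom_ext (by simpa using biprod.inl ≫= hab) (by simpa using biprod.inr ≫= hab)
  · rw [biprod.lift_eq, Preadditive.add_comp, Category.assoc, Category.assoc,
      add_eq_zero_iff_eq_neg, ← Preadditive.comp_neg, ← Preadditive.comp_neg] at ht
    refine ⟨sq.desc (biprod.inl ≫ t) (-biprod.inr ≫ t) (by simpa using ht), ?_⟩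
    ext <;> simp

/-- Two extensions of the same object, one of which has a section over the other. -/
lemma IsConflation.deflation_biprod_desc {A A' B P D : C} {i : A ⟶ A'} {p : A' ⟶ D}
    {j : B ⟶ P} {q : P ⟶ D} (h : E.IsConflation i p) (h' : E.IsConflation j q)
    (a : A' ⟶ P) (ha : a ≫ q = p) : E.deflation (biprod.desc a j) := by
  have := h'.mono
  -- The morphism `a` splits the pullback of the second extension along `p`, so this pullback is `A'
  -- ⊞ B`, and its projection to `P` inherits being a deflation from `p`.
  refine deflation_of_isPullback (p := p) (f := q) (g := biprod.fst)
    (IsPullback.of_exists_lift ?_ ?_ ?_) h.deflation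
  · ext <;> simp [ha, h'.zero]
  · intro T s t hst
    obtain ⟨l, hl⟩ := h'.exists_lift (t - s ≫ a) (by simp [ha, hst])
    exact ⟨biprod.lift s l, by simp, by simp [hl]⟩
  · intro T l l' h₁ h₂
    refine biprod.hom_ext _ _ h₁ ?_
    rw [← cancel_mono j]
    rw [biprod.desc_eq] at h₂
    simpa [reassoc_of% h₁] using h₂

end Biprod

end ExactStructure

/-! ### Diagrams of conflations and filtrations -/

namespace ExactStructure

variable {C : Type u} [Category.{v} C] [Preadditive C] {E : ExactStructure C}

/-- Two conflations starting at the same object. -/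
lemma IsConflation.exists_of_common_source [HasZeroObject C] {A B X Y Z : C} {i : A ⟶ B} {p : B ⟶ Z}
    (h₁ : E.IsConflation i p) {j : A ⟶ X} {q : X ⟶ Y} (h₂ : E.IsConflation j q) :
    ∃ (R : C) (a : X ⟶ R) (b : R ⟶ Z) (c : B ⟶ R) (e : R ⟶ Y),
      E.IsConflation a b ∧ E.IsConflation c e := by
  obtain ⟨R, a, b, c, hab, -, sq⟩ := h₁.exists_isPushout j
  exact ⟨R, a, b, c, sq.flip.desc q 0 (by simp [h₂.zero]), hab,
    h₂.of_isPushout sq.flip (by simp) (by simp)⟩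

/-- A conflation ending at `Y` and a conflation with middle term `Y`. -/
lemma IsConflation.exists_pullback_of_middle {L X Y Y' Q : C} {l : L ⟶ X} {m : X ⟶ Y}
    (h₁ : E.IsConflation l m) {a : Y' ⟶ Y} {b : Y ⟶ Q} (h₂ : E.IsConflation a b) :
    ∃ (X' : C) (l' : L ⟶ X') (m' : X' ⟶ Y') (c : X' ⟶ X),
      E.IsConflation l' m' ∧ E.IsConflation c (m ≫ b) := by
  obtain ⟨X', l', m', c, h, -, sq⟩ := h₁.exists_isPullback a
  have := h₂.mono
  refine ⟨X', l', m', c, h, isConflation_of_deflation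
    (E.deflation_comp _ _ h₁.deflation h₂.deflation) ?_ ⟨fun s t hst => ?_⟩ (fun T t ht => ?_)⟩
  · rw [sq.w_assoc, h₂.zero, comp_zero]
  · refine sq.hom_ext hst ?_
    rw [← cancel_mono a, Category.assoc, Category.assoc, ← sq.w, reassoc_of% hst]
  · obtain ⟨s, hs⟩ := h₂.exists_lift (t ≫ m) (by simpa using ht)
    exact ⟨sq.lift t s hs.symm, by simp⟩

/-- The cokernel of a composition of two inflations. -/
lemma IsConflation.exists_cokernel_comp [HasZeroObject C] [HasBinaryBiproducts C] {K L X N V : C}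
    {k : K ⟶ L} {p : L ⟶ X} (h₁ : E.IsConflation k p) {i : L ⟶ N} {q : N ⟶ V}
    (h₂ : E.IsConflation i q) :
    ∃ (W : C) (π : N ⟶ W) (e : X ⟶ W) (r : W ⟶ V) (s : X ⊞ N ⟶ W),
      E.IsConflation (k ≫ i) π ∧ E.IsConflation e r ∧
        E.IsConflation (biprod.lift p i) s := by
  obtain ⟨W, π, h⟩ := exists_isConflation_of_inflation
    (E.inflation_comp _ _ h₁.inflation h₂.inflation)
  have := h.epi
  have := h₁.epi
  have := h₂.epi
  obtain ⟨e, he⟩ := h₁.exists_desc (i ≫ π) (by simpa using h.zero)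
  obtain ⟨r, hr⟩ := h.exists_desc q (by simp [h₂.zero])
  -- Killing `K` in `N` is the same as pushing `i` out along `p`; this square yields both remaining
  -- conflations.
  have sq : IsPushout i p π e := by
    refine IsPushout.of_exists_desc he.symm (fun T s t hst => ?_) (fun T l l' hl _ => ?_)
    · obtain ⟨l, hl⟩ := h.exists_desc s (by rw [Category.assoc, hst, reassoc_of% h₁.zero, zero_comp])
      refine ⟨l, hl, ?_⟩
      rw [← cancel_epi p, reassoc_of% he, hl, hst]
    · rwa [← cancel_epi π]
  refine ⟨W, π, e, r, biprod.desc (-e) π, h, h₂.of_isPushout sq hr ?_, ?_⟩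
  · rw [← cancel_epi p, reassoc_of% he, hr, h₂.zero, comp_zero]
  · refine (isConflation_of_isPushout sq h₂.inflation).of_iso (Iso.refl _) (biprod.braiding _ _)
      (Iso.refl _) (by ext <;> simp) (by ext <;> simp)

variable {S : ObjectProperty C}

/-- The objects which can be built from zero by finitely many extensions by objects in `S`. -/
inductive Filtered (E : ExactStructure C) (S : ObjectProperty C) : C → Prop
  | zero {X : C} : IsZero X → Filtered E S X
  | extend {X Y Q : C} (i : X ⟶ Y) (p : Y ⟶ Q) : E.IsConflation i p → S Q → Filtered E S X →
      Filtered E S Y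

lemma Filtered.of_prop [HasZeroObject C] {X : C} (hX : S X) : E.Filtered S X := by
  exact .extend (0 : _ ⟶ X) (𝟙 X) (E.isConflation_of_isZero_id X (isZero_zero C) 0) hX
    (.zero (isZero_zero C))

lemma Filtered.of_iso {X Y : C} (e : X ≅ Y) (h : E.Filtered S X) : E.Filtered S Y := by
  cases h with
  | zero h => exact .zero (h.of_iso e.symm)
  | extend i p h hQ hX =>
    exact .extend (i ≫ e.hom) (e.inv ≫ p)
      (h.of_iso (Iso.refl _) e (Iso.refl _) (by simp) (by simp)) hQ hX

/-- `Filtered` adds layers on top; here one is added at the bottom, by pulling the filtration of `Y`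
back to `X`. -/
lemma Filtered.of_isConflation [HasZeroObject C] {L X Y : C} (hY : E.Filtered S Y) {l : L ⟶ X} {m : X ⟶ Y}
    (h : E.IsConflation l m) (hL : S L) : E.Filtered S X := by
  induction hY generalizing X with
  | zero hY =>
    have := h.mono
    obtain ⟨s, hs⟩ := h.exists_lift (𝟙 X) (hY.eq_of_tgt _ _)
    exact (Filtered.of_prop hL).of_iso ⟨l, s, by rw [← cancel_mono l]; simp [hs], hs⟩
  | extend a b h₂ hQ _ ih =>
    obtain ⟨X', l', m', c, h', hc⟩ := h.exists_pullback_of_middle h₂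
    exact .extend _ _ hc hQ (ih h')

/-- The chains in `Filt` have at least one step, so a zero object needs a zero layer; this is the
role of `hS`. -/
lemma Filtered.filt (hS : ∀ X : C, IsZero X → S X) {X : C} (hX : E.Filtered S X) :
    E.Filt S X := by
  induction hX with
  | @zero X h =>
    exact ⟨0, fun _ => X, fun _ => 𝟙 X, h, ⟨Iso.refl _⟩, fun i _ =>
      ⟨X, 0, by simp, (isConflation_of_isZero h h h (𝟙 X) 0).2, hS _ h⟩⟩
  | @extend X Y Q i p h hQ _ ih =>
    obtain ⟨k, F, f, h₀, ⟨e⟩, hF⟩ := ih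
    -- The old chain keeps the indices up to `k + 1`, and `Y` is placed at `k + 2`; the new
    -- inflation sits at index `k + 1`.
    let G : ℕ → C := fun n => if n ≤ k + 1 then F n else Y
    have hG {n : ℕ} (hn : n ≤ k + 1) : G n = F n := if_pos hn
    have hG' {n : ℕ} (hn : ¬ n ≤ k + 1) : G n = Y := if_neg hn
    let g : ∀ n, G n ⟶ G (n + 1) := fun n =>
      if hn : n + 1 ≤ k + 1 then eqToHom (hG (by lia)) ≫ f n ≫ eqToHom (hG hn).symm
      else if hn' : n = k + 1 then
        eqToHom ((hG hn'.le).trans (by rw [hn'])) ≫ e.hom ≫ i ≫ eqToHom (hG' hn).symm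
      else eqToHom ((hG' (by lia)).trans (hG' (by lia)).symm)
    refine ⟨k + 1, G, g, ?_, ⟨eqToIso (hG' (by simp))⟩, fun n hn => ?_⟩
    · rwa [hG (by simp)]
    · by_cases hn' : n + 1 ≤ k + 1
      · obtain ⟨Q', p', w, hp', hQ'⟩ := hF n (by lia)
        obtain ⟨w', h'⟩ := IsConflation.of_iso (i' := g n)
          (p' := eqToHom (hG hn') ≫ p') ⟨w, hp'⟩ (eqToIso (hG (by lia)).symm)
          (eqToIso (hG hn').symm) (Iso.refl _) (by simp [g, show n ≤ k by lia]) (by simp)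
        exact ⟨Q', _, w', h', hQ'⟩
      · obtain rfl : n = k + 1 := by lia
        obtain ⟨w', h'⟩ := IsConflation.of_iso (i' := g (k + 1))
          (p' := eqToHom (hG' hn') ≫ p) h (e.symm ≪≫ eqToIso (hG le_rfl).symm)
          (eqToIso (hG' hn').symm) (Iso.refl _) (by simp [g]) (by simp)
        exact ⟨Q, _, w', h', hQ⟩

end ExactStructure

/-! ### Acyclic complexes under shifts and mapping cones -/

namespace CochainComplex

variable {C : Type u} [Category.{v} C] [Preadditive C] [HasBinaryBiproducts C]

/-- The terms of the mapping cone as biproducts. -/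
@[simps]
noncomputable def mappingConeXIso {A B : CochainComplex C ℤ} (φ : A ⟶ B) (m n : ℤ)
    (h : m + 1 = n) : (mappingCone φ).X m ≅ A.X n ⊞ B.X m where
  hom := biprod.lift ((mappingCone.fst φ).1.v m n h) ((mappingCone.snd φ).v m m (add_zero m))
  inv := biprod.desc ((mappingCone.inl φ).v n m (by lia)) ((mappingCone.inr φ).f m)
  hom_inv_id := by rw [biprod.lift_desc]; exact mappingCone.id_X φ m n h
  inv_hom_id := by ext <;> simp

end CochainComplex

namespace ExactStructure

variable {C : Type u} [Category.{v} C] [Preadditive C] (E : ExactStructure C)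

/-- The monomorphism `i : Z ⟶ Kⁿ` is a kernel of the differential, and the preceding differential
factors through it by a deflation. -/
structure IsCycles (K : CochainComplex C ℤ) (n : ℤ) {Z : C} (i : Z ⟶ K.X n) : Prop where
  mono : Mono i
  exists_deflation (m : ℤ) (hm : m + 1 = n) : ∃ e : K.X m ⟶ Z, E.deflation e ∧ e ≫ i = K.d m n
  exists_lift (T : C) (t : T ⟶ K.X n) (ht : t ≫ K.d n (n + 1) = 0) : ∃ s : T ⟶ Z, s ≫ i = t

variable {E}

lemma IsCycles.comp_d {K : CochainComplex C ℤ} {n : ℤ} {Z : C} {i : Z ⟶ K.X n}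
    (h : E.IsCycles K n i) (m : ℤ) : i ≫ K.d n m = 0 := by
  obtain ⟨e, he, fac⟩ := h.exists_deflation (n - 1) (by lia)
  obtain ⟨_, _, he⟩ := exists_isConflation_of_deflation he
  have := he.epi
  rw [← cancel_epi e, reassoc_of% fac, K.d_comp_d, comp_zero]

lemma IsCycles.isConflation {K : CochainComplex C ℤ} {n m : ℤ} (hn : n + 1 = m) {Z Z' : C}
    {i : Z ⟶ K.X n} {i' : Z' ⟶ K.X m} (h : E.IsCycles K n i) (h' : E.IsCycles K m i')
    {e : K.X n ⟶ Z'} (he : E.deflation e) (fac : e ≫ i' = K.d n m) : E.IsConflation i e := by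
  have := h'.mono
  subst hn
  refine isConflation_of_deflation he ?_ h.mono (fun T t ht => h.exists_lift T t ?_)
  · rw [← cancel_mono i', Category.assoc, fac, h.comp_d, zero_comp]
  · rw [← fac, reassoc_of% ht, zero_comp]

/-- Cycle objects found independently in each degree fit together automatically, because kernels are
unique. Acyclicity can thus be checked one degree at a time. -/
lemma acyclicComplex_iff (K : CochainComplex C ℤ) :
    E.acyclicComplex K ↔ ∀ n, ∃ (Z : C) (i : Z ⟶ K.X n), E.IsCycles K n i := by
  constructor
  · rintro ⟨Z, i, p, w, h, hd⟩ n
    have h (n : ℤ) : E.IsConflation (i n) (p n) := ⟨w n, h n⟩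
    refine ⟨Z n, i n, (h n).mono, ?_, fun T t ht => (h n).exists_lift t ?_⟩
    · rintro m rfl
      exact ⟨p m, (h m).deflation, (hd m).symm⟩
    · have := (h (n + 1)).mono
      rw [← cancel_mono (i (n + 1)), Category.assoc, ← hd, ht, zero_comp]
  · intro h
    choose Z i h using h
    choose p hp fac using fun n => (h (n + 1)).exists_deflation n rfl
    have hc n := (h n).isConflation rfl (h (n + 1)) (hp n) (fac n)
    exact ⟨Z, i, p, fun n => (hc n).zero, fun n => (hc n).2, fun n => (fac n).symm⟩

lemma IsCycles.of_isZero {K : CochainComplex C ℤ} {n : ℤ} {Z : C} (i : Z ⟶ K.X n)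
    (hZ : IsZero Z) (hK : IsZero (K.X n)) (hK' : IsZero (K.X (n - 1))) : E.IsCycles K n i where
  mono := ⟨fun _ _ _ => hZ.eq_of_tgt _ _⟩
  exists_deflation m hm := by
    obtain rfl : m = n - 1 := by lia
    exact ⟨0, (isConflation_of_isZero hZ hK' hZ 0 0).deflation, hK.eq_of_tgt _ _⟩
  exists_lift T t _ := ⟨0, hK.eq_of_tgt _ _⟩

lemma acyclicComplex_of_isZero {K : CochainComplex C ℤ} (hK : IsZero K) : E.acyclicComplex K := by
  have h (n : ℤ) : IsZero (K.X n) := Functor.map_isZero (HomologicalComplex.eval _ _ n) hK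
  rw [acyclicComplex_iff]
  exact fun n => ⟨K.X n, 𝟙 _, .of_isZero _ (h _) (h _) (h _)⟩

variable [HasZeroObject C]

lemma acyclicComplex_shift {K : CochainComplex C ℤ} (hK : E.acyclicComplex K) (a : ℤ) :
    E.acyclicComplex (K⟦a⟧) := by
  rw [acyclicComplex_iff] at hK ⊢
  intro n
  obtain ⟨Z, i, h⟩ := hK (n + a)
  refine ⟨Z, i, h.mono, fun m hm => ?_, fun T t ht => h.exists_lift T t ?_⟩
  · obtain ⟨e, he, fac⟩ := h.exists_deflation (m + a) (by lia)
    -- The sign in the shifted differential is absorbed by an automorphism of `Z`.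
    refine ⟨e ≫ (a.negOnePow • Iso.refl Z).hom,
      E.deflation_comp _ _ he (deflation_of_isIso _), ?_⟩
    rw [CochainComplex.shiftFunctor_obj_d', ← fac]
    simp
  · have key (s : T ⟶ K.X (n + a)) (hs : s ≫ (a.negOnePow • K.d (n + a) (n + 1 + a)) = 0) :
        s ≫ K.d (n + a) (n + a + 1) = 0 := by
      rw [Linear.comp_units_smul, smul_eq_zero_iff_eq] at hs
      have : n + 1 + a = n + a + 1 := by lia
      rw [← this, hs]
    exact key t ht

open CochainComplex in
lemma acyclicComplex_mappingCone [HasBinaryBiproducts C] {A B : CochainComplex C ℤ} (φ : A ⟶ B)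
    (hA : E.acyclicComplex A) (hB : E.acyclicComplex B) :
    E.acyclicComplex (mappingCone φ) := by
  rw [acyclicComplex_iff] at hA hB ⊢
  intro n
  obtain ⟨Z₀, i₀, h₀⟩ := hA n
  obtain ⟨Z₁, i₁, h₁⟩ := hA (n + 1)
  obtain ⟨W₀, j₀, k₀⟩ := hB n
  obtain ⟨W₁, j₁, k₁⟩ := hB (n + 1)
  have := h₁.mono
  have := k₁.mono
  obtain ⟨p, hp, fac_p⟩ := h₁.exists_deflation n rfl
  obtain ⟨q, hq, fac_q⟩ := k₁.exists_deflation n rfl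
  have cp := h₀.isConflation rfl h₁ hp fac_p
  have cq := k₀.isConflation rfl k₁ hq fac_q
  obtain ⟨ψ, hψ⟩ := k₁.exists_lift _ (i₁ ≫ φ.f (n + 1))
    (by rw [Category.assoc, φ.comm, reassoc_of% (h₁.comp_d), zero_comp])
  -- A cycle of the cone is a cycle `x` of `A` in degree `n + 1` with some `y` in `B.X n` satisfying
  -- `d y = -φ x`. With the sign moved to `x`, these pairs form the pullback `P`, an extension of
  -- `Z₁` by `W₀`.
  obtain ⟨P, j, v, u, cP, hj, sq⟩ := cq.exists_isPullback ψ
  refine ⟨P, -(v ≫ i₁ ≫ (mappingCone.inl φ).v (n + 1) n (by lia)) +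
    u ≫ (mappingCone.inr φ).f n, ⟨fun s t hst => ?_⟩, ?_, ?_⟩
  · refine sq.hom_ext ?_ ?_
    · simpa using hst =≫ (mappingCone.snd φ).v n n (add_zero n)
    · rw [← cancel_mono i₁]
      simpa using hst =≫ (mappingCone.fst φ).1.v n (n + 1) rfl
  · rintro m rfl
    obtain ⟨q₀, hq₀, fac_q₀⟩ := k₀.exists_deflation m rfl
    obtain ⟨_, _, cq₀⟩ := exists_isConflation_of_deflation hq₀
    let a : A.X (m + 1) ⟶ P := sq.lift (φ.f (m + 1)) p (by
      rw [← cancel_mono j₁, Category.assoc, Category.assoc, fac_q, hψ, reassoc_of% fac_p, φ.comm])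
    have ha₁ : a ≫ u = φ.f (m + 1) := sq.lift_fst _ _ _
    have ha₂ : a ≫ v = p := sq.lift_snd _ _ _
    let e := mappingConeXIso φ m (m + 1) rfl
    have he : (e.hom ≫ biprod.map (𝟙 _) q₀) ≫ biprod.desc a j =
        (mappingCone.fst φ).1.v m (m + 1) rfl ≫ a +
          (mappingCone.snd φ).v m m (add_zero m) ≫ q₀ ≫ j := by
      have : biprod.map (𝟙 _) q₀ ≫ biprod.desc a j = biprod.desc a (q₀ ≫ j) := by ext <;> simp
      rw [Category.assoc, this, mappingConeXIso_hom, biprod.lift_desc]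
    -- The differential onto the cycles first covers `W₀` by `B.X m`, then covers the extension `P`
    -- by `A.X (m + 1) ⊞ W₀`.
    refine ⟨(e.hom ≫ biprod.map (𝟙 _) q₀) ≫ biprod.desc a j, E.deflation_comp _ _
      (E.deflation_comp _ _ (deflation_of_isIso _) (cq₀.biprod_id_map _).deflation)
      (cp.deflation_biprod_desc cP a ha₂), ?_⟩
    refine mappingCone.ext_to _ _ _ rfl ?_ ?_
    · simp [he, reassoc_of% ha₂, fac_p, reassoc_of% cP.zero, mappingCone.d_fst_v φ m (m + 1) _ rfl rfl]
    · simp [he, ha₁, hj, fac_q₀, mappingCone.d_snd_v φ m (m + 1) rfl]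
  · intro T t ht
    have ht₁ := ht =≫ (mappingCone.fst φ).1.v (n + 1) (n + 1 + 1) rfl
    have ht₂ := ht =≫ (mappingCone.snd φ).v (n + 1) (n + 1) (add_zero _)
    rw [Category.assoc, mappingCone.d_fst_v φ n (n + 1) _ rfl rfl] at ht₁
    rw [Category.assoc, mappingCone.d_snd_v φ n (n + 1) rfl] at ht₂
    obtain ⟨w, hw⟩ := h₁.exists_lift _ (-t ≫ (mappingCone.fst φ).1.v n (n + 1) rfl)
      (by simpa using ht₁)
    refine ⟨sq.lift (t ≫ (mappingCone.snd φ).v n n (add_zero n)) w ?_, ?_⟩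
    · rw [← cancel_mono j₁, Category.assoc, Category.assoc, Category.assoc, fac_q, hψ,
        reassoc_of% hw]
      rw [zero_comp, Preadditive.comp_add] at ht₂
      simpa using eq_neg_of_add_eq_zero_right ht₂
    · refine mappingCone.ext_to _ _ _ rfl ?_ ?_
      · simp [hw]
      · simp

end ExactStructure

/-! ### Acyclic complexes as a triangulated subcategory -/

lemma CategoryTheory.ObjectProperty.FullSubcategory.shift_obj {A : Type u} [Category.{v} A]
    [HasShift A ℤ] {P : ObjectProperty A} [P.IsStableUnderShift ℤ] (K : P.FullSubcategory) (n : ℤ) :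
    (K⟦n⟧).obj = (K.obj)⟦n⟧ := by
  with_unfolding_all rfl

/-- Replaces an abstract cone by the mapping cone of a chosen chain map, on which acyclicity can be
tested. -/
lemma BoundedHomotopy.exists_iso_mappingCone {C : Type u} [Category.{v} C] [Preadditive C]
    [HasZeroObject C] [HasBinaryBiproducts C] {X Y Z : BoundedHomotopyCategory C} {f : X ⟶ Y}
    {g : Y ⟶ Z} {h : Z ⟶ X⟦(1 : ℤ)⟧} (hT : Triangle.mk f g h ∈ distTriang _)
    (φ : X.obj.as ⟶ Y.obj.as) (hφ : (HomotopyCategory.quotient _ _).map φ = f.hom) :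
    ∃ (hb : BoundedHomotopy.bounded C ((HomotopyCategory.quotient _ _).obj
      (CochainComplex.mappingCone φ))) (e : Z ≅ ⟨_, hb⟩),
      g ≫ e.hom = ⟨(HomotopyCategory.quotient _ _).map (CochainComplex.mappingCone.inr φ)⟩ := by
  have hb : BoundedHomotopy.bounded C ((HomotopyCategory.quotient _ _).obj
      (CochainComplex.mappingCone φ)) := by
    rw [BoundedHomotopy.bounded_quotient_obj_iff]
    exact BoundedHomotopy.boundedComplex_mappingCone C φ
      ((BoundedHomotopy.bounded_quotient_obj_iff _).1 X.property)
      ((BoundedHomotopy.bounded_quotient_obj_iff _).1 Y.property)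
  let e := isoTriangleOfIso₁₂ ((BoundedHomotopy.bounded C).ι.mapTriangle.obj (Triangle.mk f g h)) _ hT
    (HomotopyCategory.mappingCone_triangleh_distinguished φ) (Iso.refl _) (Iso.refl _)
    ((Category.comp_id _).trans (hφ.symm.trans (Category.id_comp _).symm))
  refine ⟨hb, (BoundedHomotopy.bounded C).fullyFaithfulι.preimageIso (Triangle.π₃.mapIso e), ?_⟩
  apply (BoundedHomotopy.bounded C).ι.map_injective
  refine (Functor.map_comp _ _ _).trans ?_
  exact e.hom.comm₂.trans (Category.id_comp _)

namespace ExactStructure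

variable {C : Type u} [Category.{v} C] [Preadditive C] {E : ExactStructure C}

lemma acyclic_quotient_obj_iff {K : CochainComplex C ℤ}
    (hK : BoundedHomotopy.bounded C ((HomotopyCategory.quotient _ _).obj K)) :
    E.acyclic ⟨(HomotopyCategory.quotient _ _).obj K, hK⟩ ↔ E.acyclicComplex K := by
  refine ⟨?_, fun h => ⟨_, h⟩⟩
  simp only [acyclic, ObjectProperty.prop_inverseImage_iff, ObjectProperty.strictMap_iff]
  rintro ⟨L, h, hL⟩
  obtain rfl : L = K := congr_arg Quotient.as hL
  exact h

lemma acyclic_iff (K : BoundedHomotopyCategory C) : E.acyclic K ↔ E.acyclicComplex K.obj.as :=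
  acyclic_quotient_obj_iff K.property

variable [HasZeroObject C] [HasBinaryBiproducts C]

open scoped ZeroObject in
instance : E.acyclic.ContainsZero where
  exists_zero := by
    have h : IsZero ((HomotopyCategory.quotient C (ComplexShape.up ℤ)).obj 0) :=
      Functor.map_isZero _ (isZero_zero _)
    have hb : BoundedHomotopy.bounded C ((HomotopyCategory.quotient _ _).obj 0) := by
      rw [BoundedHomotopy.bounded_quotient_obj_iff]
      exact ⟨0, 0, inferInstance, inferInstance⟩
    refine ⟨⟨_, hb⟩, ?_, (acyclic_quotient_obj_iff hb).2 (acyclicComplex_of_isZero (isZero_zero _))⟩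
    rw [IsZero.iff_id_eq_zero]
    exact (BoundedHomotopy.bounded C).ι.map_injective (h.eq_of_src _ _)

instance : E.acyclic.IsStableUnderShift ℤ where
  isStableUnderShiftBy n :=
    { le_shift := fun K hK => by
        obtain ⟨K, hb⟩ := K
        obtain ⟨K, rfl⟩ := K.quotient_obj_surjective
        rw [acyclic_quotient_obj_iff] at hK
        rw [ObjectProperty.prop_shift_iff]
        change E.acyclicComplex.strictMap (HomotopyCategory.quotient _ _)
          ((shiftFunctor (BoundedHomotopyCategory C) n).obj _).obj
        rw [ObjectProperty.FullSubcategory.shift_obj, HomotopyCategory.shift_quotient_obj]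
        exact ⟨_, acyclicComplex_shift hK n⟩ }

instance : E.acyclic.IsTriangulatedClosed₃ where
  ext₃' T hT h₁ h₂ := by
    obtain ⟨f : T.obj₁.obj.as ⟶ T.obj₂.obj.as, hf⟩ :=
      (HomotopyCategory.quotient _ _).map_surjective T.mor₁.hom
    rw [acyclic_iff] at h₁ h₂
    obtain ⟨hb, e, -⟩ := BoundedHomotopy.exists_iso_mappingCone hT f hf
    exact ⟨_, (acyclic_quotient_obj_iff hb).2 (acyclicComplex_mappingCone f h₁ h₂), ⟨e⟩⟩

instance : E.acyclic.IsTriangulated where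
  toIsTriangulatedClosed₂ := .of_isTriangulatedClosed₃

end ExactStructure

/-! ### From conflations to distinguished triangles -/

namespace ExactStructure

variable {C : Type u} [Category.{v} C] [Preadditive C] {E : ExactStructure C}
  [HasBinaryBiproducts C]

section

open CochainComplex

/-- The morphism from the mapping cone of `a` to `D` given by a complex `A ⟶ B ⟶ D`. -/
noncomputable def mappingConeToCokernel {A B D : CochainComplex C ℤ} (a : A ⟶ B) (b : B ⟶ D)
    (w : a ≫ b = 0) : mappingCone a ⟶ D :=
  mappingCone.desc a 0 b (by simp [w])

lemma inr_mappingConeToCokernel {A B D : CochainComplex C ℤ} (a : A ⟶ B) (b : B ⟶ D)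
    (w : a ≫ b = 0) : mappingCone.inr a ≫ mappingConeToCokernel a b w = b :=
  mappingCone.inr_desc _ _ _ _

variable [HasZeroObject C]

lemma deflation_mappingCone_fst {A B : CochainComplex C ℤ} (φ : A ⟶ B) (m n : ℤ) (h : m + 1 = n) :
    E.deflation ((mappingCone.fst φ).1.v m n h) := by
  have : (mappingCone.fst φ).1.v m n h = (mappingConeXIso φ m n h).hom ≫ biprod.fst := by simp
  rw [this]
  exact E.deflation_comp _ _ (deflation_of_isIso _) (E.isConflation_inr_fst _ _).deflation

/-- The comparison from the cone of `a` to the cokernel is a quasi-isomorphism. In degree `n` its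
cone has the summands `A.X (n + 2)`, `B.X (n + 1)` and `D.X n`; the cycles vanish in the first, lie
in `A.X (n + 1)` in the second and are arbitrary in the third. Assuming zero differentials treats
all degrees of single complexes uniformly. -/
lemma acyclicComplex_mappingConeToCokernel {A B D : CochainComplex C ℤ} (a : A ⟶ B) (b : B ⟶ D)
    (w : a ≫ b = 0) (hA : ∀ n m, A.d n m = 0) (hB : ∀ n m, B.d n m = 0) (hD : ∀ n m, D.d n m = 0)
    (h : ∀ n, E.IsConflation (a.f n) (b.f n)) :
    E.acyclicComplex (mappingCone (mappingConeToCokernel a b w)) := by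
  have hπ (n : ℤ) : (mappingConeToCokernel a b w).f n =
      (mappingCone.snd a).v n n (add_zero n) ≫ b.f n := by
    simp [mappingConeToCokernel, mappingCone.desc_f a _ _ _ n _ rfl]
  have hd (n m : ℤ) (hnm : n + 1 = m) : (mappingCone a).d n m =
      (mappingCone.fst a).1.v n m hnm ≫ a.f m ≫ (mappingCone.inr a).f m := by
    subst hnm
    refine mappingCone.ext_to _ _ _ rfl ?_ ?_
    · rw [mappingCone.d_fst_v a n (n + 1) _ rfl rfl]
      simp [hA]
    · rw [mappingCone.d_snd_v a n (n + 1) rfl]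
      simp [hB]
  generalize mappingConeToCokernel a b w = π at *
  rw [acyclicComplex_iff]
  intro n
  have := (h (n + 1)).mono
  have := (h (n + 1 + 1)).mono
  refine ⟨A.X (n + 1) ⊞ D.X n, biprod.desc (-a.f (n + 1) ≫ (mappingCone.inr a).f (n + 1) ≫
    (mappingCone.inl π).v (n + 1) n (by lia)) ((mappingCone.inr π).f n), ⟨fun s t hst => ?_⟩,
    ?_, ?_⟩
  · simp only [biprod.desc_eq, Preadditive.comp_add] at hst
    refine biprod.hom_ext _ _ ?_ ?_
    · rw [← cancel_mono (a.f (n + 1))]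
      simpa using (hst =≫ (mappingCone.fst π).1.v n (n + 1) rfl) =≫
        (mappingCone.snd a).v (n + 1) (n + 1) (add_zero _)
    · simpa using hst =≫ (mappingCone.snd π).v n n (add_zero n)
  · rintro m rfl
    refine ⟨(mappingCone.fst π).1.v m (m + 1) rfl ≫ (mappingConeXIso a (m + 1) _ rfl).hom ≫
      biprod.map (𝟙 _) (b.f (m + 1)),
      E.deflation_comp _ _ (deflation_mappingCone_fst π m (m + 1) rfl) (E.deflation_comp _ _
        (deflation_of_isIso _) ((h _).biprod_id_map _).deflation), ?_⟩
    have he : (mappingConeXIso a (m + 1) _ rfl).hom ≫ biprod.map (𝟙 _) (b.f (m + 1)) =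
        (mappingCone.fst a).1.v (m + 1) _ rfl ≫ biprod.inl +
          (mappingCone.snd a).v (m + 1) (m + 1) (add_zero _) ≫ b.f (m + 1) ≫ biprod.inr := by
      refine biprod.hom_ext _ _ ?_ ?_ <;> simp
    rw [he]
    refine mappingCone.ext_to _ _ _ rfl ?_ ?_
    · rw [mappingCone.d_fst_v π m (m + 1) _ rfl rfl, hd _ _ rfl]
      simp
    · rw [mappingCone.d_snd_v π m (m + 1) rfl, hπ]
      simp [hD]
  · intro T t ht
    have ht₁ := ht =≫ (mappingCone.fst π).1.v (n + 1) (n + 1 + 1) rfl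
    have ht₂ := ht =≫ (mappingCone.snd π).v (n + 1) (n + 1) (add_zero _)
    rw [Category.assoc, mappingCone.d_fst_v π n (n + 1) _ rfl rfl, hd _ _ rfl] at ht₁
    rw [Category.assoc, mappingCone.d_snd_v π n (n + 1) rfl, hπ, hD] at ht₂
    have hx : t ≫ (mappingCone.fst π).1.v n (n + 1) rfl ≫
        (mappingCone.fst a).1.v (n + 1) (n + 1 + 1) rfl = 0 := by
      rw [← cancel_mono (a.f (n + 1 + 1))]
      simpa using ht₁ =≫ (mappingCone.snd a).v _ _ (add_zero _)
    obtain ⟨s, hs⟩ := (h (n + 1)).exists_lift (t ≫ (mappingCone.fst π).1.v n (n + 1) rfl ≫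
      (mappingCone.snd a).v (n + 1) (n + 1) (add_zero _)) (by simpa using ht₂)
    refine ⟨biprod.lift (-s) (t ≫ (mappingCone.snd π).v n n (add_zero n)), ?_⟩
    rw [biprod.lift_desc]
    refine mappingCone.ext_to _ _ _ rfl ?_ ?_
    · refine mappingCone.ext_to _ _ _ rfl ?_ ?_
      · simp [hx]
      · simp [hs]
    · simp

end

end ExactStructure

/-- The functor to the bounded homotopy category given by complexes concentrated in degree `0`. -/
noncomputable def BoundedHomotopyCategory.singleFunctor (C : Type u) [Category.{v} C]
    [Preadditive C] [HasZeroObject C] : C ⥤ BoundedHomotopyCategory C :=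
  (BoundedHomotopy.bounded C).lift (HomotopyCategory.singleFunctor C 0)
    (BoundedHomotopy.bounded_singleFunctor_obj C 0)

/-- Once `π` is inverted, `Z` may replace the cone `K`. It is applied to the cone of an inflation
and its comparison with the cokernel. -/
lemma CategoryTheory.Functor.exists_distinguished_of_isIso_map {A : Type*} [Category* A]
    [Preadditive A] [HasZeroObject A] [HasShift A ℤ] [∀ n : ℤ, (shiftFunctor A n).Additive]
    [Pretriangulated A] {D : Type*} [Category* D] [Preadditive D] [HasZeroObject D] [HasShift D ℤ]
    [∀ n : ℤ, (shiftFunctor D n).Additive] [Pretriangulated D] (F : A ⥤ D) [F.CommShift ℤ]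
    [F.IsTriangulated] {X Y K Z : A} {f : X ⟶ Y} {g : Y ⟶ K} {k : K ⟶ X⟦(1 : ℤ)⟧}
    (hT : Triangle.mk f g k ∈ distTriang _) (π : K ⟶ Z) [IsIso (F.map π)] :
    ∃ δ : F.obj Z ⟶ (F.obj X)⟦(1 : ℤ)⟧,
      Triangle.mk (F.map f) (F.map (g ≫ π)) δ ∈ distTriang _ :=
  ⟨(asIso (F.map π)).inv ≫ F.map k ≫ (F.commShiftIso (1 : ℤ)).hom.app _,
    isomorphic_distinguished _ (F.map_distinguished _ hT) _
      (Triangle.isoMk _ _ (Iso.refl _) (Iso.refl _) (asIso (F.map π)).symm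
        ((Category.comp_id _).trans (Category.id_comp _).symm)
        (Eq.trans (show F.map (g ≫ π) ≫ (asIso (F.map π)).inv = F.map g by simp)
          (Category.id_comp _).symm)
        ((congr_arg (_ ≫ ·) ((shiftFunctor D (1 : ℤ)).map_id _)).trans (Category.comp_id _)))⟩

namespace ExactStructure

variable {C : Type u} [Category.{v} C] [Preadditive C] {E : ExactStructure C} [HasZeroObject C]

lemma isConflation_single_map {X Y Z : C} {i : X ⟶ Y} {p : Y ⟶ Z} (h : E.IsConflation i p)
    (n : ℤ) : E.IsConflation (((HomologicalComplex.single C (.up ℤ) 0).map i).f n)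
      (((HomologicalComplex.single C (.up ℤ) 0).map p).f n) := by
  by_cases hn : n = 0
  · subst hn
    exact h.of_iso (HomologicalComplex.singleObjXSelf (.up ℤ) 0 X).symm
      (HomologicalComplex.singleObjXSelf (.up ℤ) 0 Y).symm
      (HomologicalComplex.singleObjXSelf (.up ℤ) 0 Z).symm
      (by simp [HomologicalComplex.single_map_f_self])
      (by simp [HomologicalComplex.single_map_f_self])
  · exact isConflation_of_isZero (HomologicalComplex.isZero_single_obj_X _ _ _ _ hn)
      (HomologicalComplex.isZero_single_obj_X _ _ _ _ hn)
      (HomologicalComplex.isZero_single_obj_X _ _ _ _ hn) _ _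

variable [HasBinaryBiproducts C]

lemma trW_of_acyclicComplex_mappingCone {K L : BoundedHomotopyCategory C} (f : K ⟶ L)
    (g : K.obj.as ⟶ L.obj.as) (hg : (HomotopyCategory.quotient _ _).map g = f.hom)
    (h : E.acyclicComplex (CochainComplex.mappingCone g)) : E.acyclic.trW f := by
  obtain ⟨Z, a, b, hT⟩ := distinguished_cocone_triangle f
  obtain ⟨hb, e, -⟩ := BoundedHomotopy.exists_iso_mappingCone hT g hg
  -- The cone is only isomorphic to an acyclic complex, and `acyclic` is defined by equality of
  -- objects.
  rw [← ObjectProperty.trW_isoClosure]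
  exact ⟨Z, a, b, hT, _, (acyclic_quotient_obj_iff hb).2 h, ⟨e⟩⟩

variable (E) in
/-- The functor to the bounded derived category. -/
noncomputable def toDerived : C ⥤ E.BoundedDerivedCategory :=
  BoundedHomotopyCategory.singleFunctor C ⋙ E.acyclic.trW.Q

instance : (BoundedHomotopyCategory.singleFunctor C).Additive where
  map_add {X Y f g} := by
    apply (BoundedHomotopy.bounded C).ι.map_injective
    exact (HomotopyCategory.singleFunctor C 0).map_add

instance : E.toDerived.Additive := inferInstanceAs (_ ⋙ _).Additive

lemma IsConflation.exists_trW {X Y Z : C} {i : X ⟶ Y} {p : Y ⟶ Z} (h : E.IsConflation i p) :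
    ∃ (K : BoundedHomotopyCategory C) (g : (BoundedHomotopyCategory.singleFunctor C).obj Y ⟶ K)
      (k : K ⟶ ((BoundedHomotopyCategory.singleFunctor C).obj X)⟦(1 : ℤ)⟧)
      (π : K ⟶ (BoundedHomotopyCategory.singleFunctor C).obj Z),
      Triangle.mk ((BoundedHomotopyCategory.singleFunctor C).map i) g k ∈ distTriang _ ∧
        E.acyclic.trW π ∧ g ≫ π = (BoundedHomotopyCategory.singleFunctor C).map p := by
  let a := (CochainComplex.singleFunctor C 0).map i
  let b := (CochainComplex.singleFunctor C 0).map p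
  have w : a ≫ b = 0 := by
    rw [← Functor.map_comp, h.zero, Functor.map_zero]
  obtain ⟨K, g, k, hT⟩ := distinguished_cocone_triangle
    ((BoundedHomotopyCategory.singleFunctor C).map i)
  obtain ⟨hb, e, he⟩ := BoundedHomotopy.exists_iso_mappingCone hT a rfl
  let π : (⟨_, hb⟩ : BoundedHomotopyCategory C) ⟶ (BoundedHomotopyCategory.singleFunctor C).obj Z :=
    ⟨(HomotopyCategory.quotient _ _).map (mappingConeToCokernel a b w)⟩
  have hπ : E.acyclic.trW π := by
    refine trW_of_acyclicComplex_mappingCone π (mappingConeToCokernel a b w) rfl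
      (acyclicComplex_mappingConeToCokernel a b w (fun _ _ => rfl) (fun _ _ => rfl)
        (fun _ _ => rfl) (isConflation_single_map h))
  refine ⟨K, g, k, e.hom ≫ π, hT, (MorphismProperty.cancel_left_of_respectsIso _ _ _).2 hπ, ?_⟩
  refine (Category.assoc _ _ _).symm.trans ((congr_arg (· ≫ π) he).trans ?_)
  apply (BoundedHomotopy.bounded C).ι.map_injective
  refine ((HomotopyCategory.quotient _ _).map_comp _ _).symm.trans ?_
  exact congr_arg (HomotopyCategory.quotient _ _).map (inr_mappingConeToCokernel a b w)

/-- A conflation induces a distinguished triangle in the bounded derived category. -/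
lemma IsConflation.exists_distinguished {X Y Z : C} {i : X ⟶ Y} {p : Y ⟶ Z}
    (h : E.IsConflation i p) :
    ∃ δ : E.toDerived.obj Z ⟶ (E.toDerived.obj X)⟦(1 : ℤ)⟧,
      Triangle.mk (E.toDerived.map i) (E.toDerived.map p) δ ∈ distTriang _ := by
  obtain ⟨K, g, k, π, hT, hπ, fac⟩ := h.exists_trW
  have := Localization.inverts E.acyclic.trW.Q E.acyclic.trW π hπ
  have := E.acyclic.trW.Q.exists_distinguished_of_isIso_map hT π
  rwa [fac] at this

end ExactStructure

/-! ### Fullness of the functor to the bounded derived category -/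

namespace HomotopyCategory

variable {C : Type u} [Category.{v} C] [Preadditive C]

lemma quotient_map_eq_zero_of_d_eq_zero {K L : CochainComplex C ℤ} (f : K ⟶ L)
    (hL : ∀ n m, L.d n m = 0)
    (h : ∀ n m, n + 1 = m → ∃ s : K.X m ⟶ L.X n, K.d n m ≫ s = f.f n) :
    (HomotopyCategory.quotient C (ComplexShape.up ℤ)).map f = 0 := by
  have h' (i j : ℤ) : ∃ s : K.X i ⟶ L.X j,
      (j + 1 = i → K.d j i ≫ s = f.f j) ∧ (¬ j + 1 = i → s = 0) := by
    by_cases hij : j + 1 = i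
    · obtain ⟨s, hs⟩ := h j i hij
      exact ⟨s, fun _ => hs, fun h => (h hij).elim⟩
    · exact ⟨0, fun h => (hij h).elim, fun _ => rfl⟩
  choose s hs hs' using h'
  rw [← Functor.map_zero (HomotopyCategory.quotient C (ComplexShape.up ℤ))]
  refine HomotopyCategory.eq_of_homotopy _ _ ⟨s, hs', fun i => ?_⟩
  rw [dNext_eq s (show (ComplexShape.up ℤ).Rel i (i + 1) from rfl),
    prevD_eq s (show (ComplexShape.up ℤ).Rel (i - 1) i from sub_add_cancel i 1), hL,
    hs _ _ rfl]
  simp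

end HomotopyCategory

namespace ExactStructure

variable {C : Type u} [Category.{v} C] [Preadditive C] {E : ExactStructure C}

/-- Only the component in degree `-1` matters. It kills the boundaries from degree `-2`, which cover
the kernel of the deflation `L.d (-1) 0`, so it factors through this deflation; the factor is a
null-homotopy. -/
lemma quotient_map_eq_zero_of_acyclicComplex {L D : CochainComplex C ℤ}
    (hL : E.acyclicComplex L) (hL' : E.deflation (L.d (-1) 0)) (hD : ∀ n m, D.d n m = 0)
    (hD' : ∀ n, n ≠ -1 → IsZero (D.X n)) (f : L ⟶ D) :
    (HomotopyCategory.quotient C (ComplexShape.up ℤ)).map f = 0 := by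
  refine HomotopyCategory.quotient_map_eq_zero_of_d_eq_zero f hD ?_
  rintro n m rfl
  by_cases hn : n = -1
  · subst hn
    obtain ⟨Z', k, hk⟩ := exists_isConflation_of_deflation hL'
    obtain ⟨Z, i, h⟩ := (acyclicComplex_iff L).1 hL (-1)
    obtain ⟨e, he, fac⟩ := h.exists_deflation (-2) (by lia)
    obtain ⟨_, _, he⟩ := exists_isConflation_of_deflation he
    have := he.epi
    obtain ⟨s, hs⟩ := h.exists_lift _ k hk.zero
    refine hk.exists_desc _ ?_
    have hi : i ≫ f.f (-1) = 0 := by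
      rw [← cancel_epi e, reassoc_of% fac, ← f.comm, hD, comp_zero, comp_zero]
    rw [← hs, Category.assoc, hi, comp_zero]
  · exact ⟨0, (hD' n hn).eq_of_tgt _ _⟩

variable [HasZeroObject C]

open scoped ZeroObject in
/-- The truncation of an acyclic complex in nonpositive degrees. -/
lemma exists_truncation {K : CochainComplex C ℤ} (hK : E.acyclicComplex K) :
    ∃ (L : CochainComplex C ℤ) (ι : L ⟶ K), E.acyclicComplex L ∧ (∀ n, Mono (ι.f n)) ∧
      E.IsCycles K 0 (ι.f 0) ∧ E.deflation (L.d (-1) 0) := by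
  rw [acyclicComplex_iff] at hK
  have h₁ (n : ℤ) : ∃ (W : C) (j : W ⟶ K.X n), Mono j ∧ (n < 0 → IsIso j) ∧
      (n = 0 → E.IsCycles K n j) ∧ (0 < n → IsZero W) := by
    rcases lt_trichotomy n 0 with hn | rfl | hn
    · exact ⟨K.X n, 𝟙 _, inferInstance, fun _ => inferInstance, fun _ => by lia, fun _ => by lia⟩
    · obtain ⟨Z, i, h⟩ := hK 0
      exact ⟨Z, i, h.mono, fun _ => by lia, fun _ => h, fun _ => by lia⟩
    · exact ⟨0, 0, ⟨fun _ _ _ => (isZero_zero C).eq_of_tgt _ _⟩, fun _ => by lia,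
        fun _ => by lia, fun _ => isZero_zero C⟩
  choose W j hj hneg hcyc hpos using h₁
  have h₂ (n m : ℤ) : ∃ d : W n ⟶ W m, d ≫ j m = j n ≫ K.d n m := by
    by_cases hnm : n + 1 = m
    · rcases lt_trichotomy m 0 with hm | rfl | hm
      · have := hneg m hm
        exact ⟨j n ≫ K.d n m ≫ inv (j m), by simp⟩
      · exact (hcyc 0 rfl).exists_lift _ _ (by simp)
      · refine ⟨0, ?_⟩
        rcases eq_or_lt_of_le (show 0 ≤ n by lia) with rfl | hn
        · rw [(hcyc 0 rfl).comp_d, zero_comp]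
        · exact (hpos n hn).eq_of_src _ _
    · exact ⟨0, by rw [K.shape _ _ hnm, zero_comp, comp_zero]⟩
  choose d hd using h₂
  let L : CochainComplex C ℤ :=
    { X := W
      d := d
      shape := fun n m hnm => by
        rw [← cancel_mono (j m), hd, K.shape _ _ hnm, zero_comp, comp_zero]
      d_comp_d' := fun n m k _ _ => by
        rw [← cancel_mono (j k), Category.assoc, hd, reassoc_of% hd n m, K.d_comp_d, zero_comp,
          comp_zero] }
  obtain ⟨e, he, fac⟩ := (hcyc 0 rfl).exists_deflation (-1) (by lia)
  have hd₀ : E.deflation (d (-1) 0) := by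
    have : d (-1) 0 = j (-1) ≫ e := by rw [← cancel_mono (j 0), hd, Category.assoc, fac]
    rw [this]
    have := hneg (-1) (by lia)
    exact E.deflation_comp _ _ (deflation_of_isIso _) he
  refine ⟨L, { f := j, comm' := fun n m _ => (hd n m).symm }, ?_, hj, hcyc 0 rfl, hd₀⟩
  rw [acyclicComplex_iff]
  intro n
  rcases lt_trichotomy n 0 with hn | rfl | hn
  · obtain ⟨Z, i, h⟩ := hK n
    have := hneg n hn
    have := h.mono
    refine ⟨Z, i ≫ inv (j n), inferInstance, fun m hm => ?_, fun T t ht => ?_⟩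
    · obtain ⟨e, he, fac⟩ := h.exists_deflation m hm
      have := hneg m (by lia)
      refine ⟨j m ≫ e, E.deflation_comp _ _ (deflation_of_isIso _) he, ?_⟩
      rw [Category.assoc, reassoc_of% fac, ← Category.assoc, IsIso.comp_inv_eq]
      exact (hd m n).symm
    · obtain ⟨s, hs⟩ := h.exists_lift T (t ≫ j n) (by
        have ht : t ≫ d n (n + 1) = 0 := ht
        rw [Category.assoc, ← hd, reassoc_of% ht, zero_comp])
      exact ⟨s, by rw [reassoc_of% hs, IsIso.hom_inv_id, Category.comp_id]⟩
  · refine ⟨W 0, 𝟙 _, inferInstance, fun m hm => ?_, fun T t _ => ⟨t, Category.comp_id _⟩⟩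
    obtain rfl : m = -1 := by lia
    exact ⟨d (-1) 0, hd₀, Category.comp_id _⟩
  · refine ⟨W n, 𝟙 _, inferInstance, fun m hm => ?_, fun T t _ => ⟨t, Category.comp_id _⟩⟩
    exact ⟨d m n, (E.isConflation_id_of_isZero _ (hpos n hn) _).deflation, Category.comp_id _⟩

lemma exists_lift_truncation {K L : CochainComplex C ℤ} (ι : L ⟶ K) (hι : ∀ n, Mono (ι.f n))
    (h : E.IsCycles K 0 (ι.f 0)) {X : C} (g : (HomologicalComplex.single C (.up ℤ) 0).obj X ⟶ K) :
    ∃ l : (HomologicalComplex.single C (.up ℤ) 0).obj X ⟶ L, l ≫ ι = g := by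
  have h' (n : ℤ) : ∃ l : ((HomologicalComplex.single C (.up ℤ) 0).obj X).X n ⟶ L.X n,
      l ≫ ι.f n = g.f n := by
    by_cases hn : n = 0
    · subst hn
      exact h.exists_lift _ _ (by rw [g.comm, HomologicalComplex.single_obj_d, zero_comp])
    · exact ⟨0, (HomologicalComplex.isZero_single_obj_X _ _ _ _ hn).eq_of_src _ _⟩
  choose l hl using h'
  refine ⟨{ f := l, comm' := fun n m _ => ?_ }, HomologicalComplex.hom_ext _ _ hl⟩
  rw [← cancel_mono (ι.f m), Category.assoc, Category.assoc, hl, ← ι.comm, reassoc_of% hl, g.comm]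

end ExactStructure

namespace CategoryTheory.Pretriangulated

variable {A : Type*} [Category* A] [Preadditive A] [HasZeroObject A] [HasShift A ℤ]
  [∀ n : ℤ, (shiftFunctor A n).Additive] [Pretriangulated A]

lemma exists_eq_comp_of_distinguished {K X L Y : A} {s : K ⟶ X} {g : X ⟶ L} {h : L ⟶ K⟦(1 : ℤ)⟧}
    (hT : Triangle.mk s g h ∈ distTriang _) (f : K ⟶ Y) (hf : h ≫ f⟦(1 : ℤ)⟧' = 0) :
    ∃ f' : X ⟶ Y, f = s ≫ f' := by
  obtain ⟨f', hf'⟩ := Triangle.yoneda_exact₃ _ (rot_of_distTriang _ hT) (f⟦(1 : ℤ)⟧') hf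
  obtain ⟨f' : X ⟶ Y, rfl⟩ := (shiftFunctor A (1 : ℤ)).map_surjective f'
  refine ⟨-f', (shiftFunctor A (1 : ℤ)).map_injective ?_⟩
  have hf' : f⟦(1 : ℤ)⟧' = (-s⟦(1 : ℤ)⟧') ≫ f'⟦(1 : ℤ)⟧' := hf'
  rw [hf', Preadditive.neg_comp, ← Functor.map_comp, ← Functor.map_neg, Preadditive.comp_neg]

end CategoryTheory.Pretriangulated

namespace CategoryTheory.ObjectProperty

variable {A : Type*} [Category* A] [Preadditive A] [HasZeroObject A] [HasShift A ℤ]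
  [∀ n : ℤ, (shiftFunctor A n).Additive] [Pretriangulated A] [IsTriangulated A]
  (P : ObjectProperty A) [P.IsTriangulated]

/-- A criterion for a morphism in the Verdier quotient to come from a morphism. -/
lemma exists_map_eq_of_factorization {X Y : A}
    (h : ∀ (Z : A) (_ : P Z) (g : X ⟶ Z), ∃ (L : A) (_ : P L) (l : X ⟶ L) (ι : L ⟶ Z), l ≫ ι = g ∧
      ∀ φ : L ⟶ Y⟦(1 : ℤ)⟧, φ = 0) (α : P.trW.Q.obj X ⟶ P.trW.Q.obj Y) :
    ∃ f : X ⟶ Y, α = P.trW.Q.map f := by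
  obtain ⟨φ, rfl⟩ := Localization.exists_rightFraction P.trW.Q P.trW α
  obtain ⟨Z, g, k, hT, hZ⟩ := φ.hs
  obtain ⟨L, hL, l, ι, fac, hY⟩ := h Z hZ g
  -- The roof `X ← φ.X' → Y` is refined along `a`, so that the cone of its left leg becomes `L`.
  -- Since `L` has no nonzero morphism to `Y⟦1⟧`, the right leg then extends over `X`.
  obtain ⟨K', s', k', hT'⟩ := distinguished_cocone_triangle₁ l
  have hs' : P.trW s' := ⟨L, l, k', hT', hL⟩
  obtain ⟨a : K' ⟶ φ.X', ha, -⟩ := complete_distinguished_triangle_morphism₁ _ _ hT' hT (𝟙 X) ι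
    (show l ≫ ι = 𝟙 X ≫ g by rw [fac, Category.id_comp])
  have ha : s' ≫ 𝟙 X = a ≫ φ.s := ha
  rw [Category.comp_id] at ha
  obtain ⟨f', hf'⟩ := exists_eq_comp_of_distinguished hT' (a ≫ φ.f) (hY _)
  refine ⟨f', ?_⟩
  have := Localization.inverts P.trW.Q P.trW φ.s φ.hs
  have := Localization.inverts P.trW.Q P.trW s' hs'
  rw [← cancel_epi (P.trW.Q.map s'), ← Functor.map_comp, ← hf', ha, Functor.map_comp,
    Functor.map_comp, Category.assoc, MorphismProperty.RightFraction.map_s_comp_map]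

end CategoryTheory.ObjectProperty

namespace ExactStructure

variable {C : Type u} [Category.{v} C] [Preadditive C] {E : ExactStructure C} [HasZeroObject C]
  [HasBinaryBiproducts C]

instance : (BoundedHomotopyCategory.singleFunctor C).Full where
  map_surjective {X Y} f := by
    obtain ⟨g : (CochainComplex.singleFunctor C 0).obj X ⟶ (CochainComplex.singleFunctor C 0).obj Y,
      hg⟩ := (HomotopyCategory.quotient _ _).map_surjective f.hom
    obtain ⟨h, rfl⟩ := (CochainComplex.singleFunctor C 0).map_surjective g
    exact ⟨h, (BoundedHomotopy.bounded C).ι.map_injective hg⟩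

/-- Here `L` is the truncation in nonpositive degrees: a chain map from an object in degree `0`
lands in the cycles, hence factors through it. -/
lemma exists_factorization_of_acyclic {A : BoundedHomotopyCategory C} (hA : E.acyclic A) {X : C}
    (g : (BoundedHomotopyCategory.singleFunctor C).obj X ⟶ A) (Y : C) :
    ∃ (L : BoundedHomotopyCategory C) (_ : E.acyclic L)
      (l : (BoundedHomotopyCategory.singleFunctor C).obj X ⟶ L) (ι : L ⟶ A), l ≫ ι = g ∧
      ∀ φ : L ⟶ ((BoundedHomotopyCategory.singleFunctor C).obj Y)⟦(1 : ℤ)⟧, φ = 0 := by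
  obtain ⟨K, hb⟩ := A
  obtain ⟨K, rfl⟩ := K.quotient_obj_surjective
  rw [acyclic_quotient_obj_iff] at hA
  obtain ⟨γ : (HomologicalComplex.single C (.up ℤ) 0).obj X ⟶ K, hγ⟩ :=
    (HomotopyCategory.quotient _ _).map_surjective g.hom
  obtain ⟨L, ι, hL, hι, hcyc, hd⟩ := exists_truncation hA
  obtain ⟨l, fac⟩ := exists_lift_truncation ι hι hcyc γ
  have hbL : BoundedHomotopy.bounded C ((HomotopyCategory.quotient _ _).obj L) := by
    rw [BoundedHomotopy.bounded_quotient_obj_iff] at hb ⊢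
    obtain ⟨a, b, _, _⟩ := hb
    refine ⟨a, b, ?_, ?_⟩
    · rw [CochainComplex.isStrictlyGE_iff]
      exact fun n hn => IsZero.of_mono (ι.f n) (CochainComplex.isZero_of_isStrictlyGE K a n hn)
    · rw [CochainComplex.isStrictlyLE_iff]
      exact fun n hn => IsZero.of_mono (ι.f n) (CochainComplex.isZero_of_isStrictlyLE K b n hn)
  refine ⟨⟨_, hbL⟩, (acyclic_quotient_obj_iff hbL).2 hL, ⟨(HomotopyCategory.quotient _ _).map l⟩,
    ⟨(HomotopyCategory.quotient _ _).map ι⟩, ?_, fun φ => ?_⟩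
  · apply (BoundedHomotopy.bounded C).ι.map_injective
    refine ((HomotopyCategory.quotient _ _).map_comp _ _).symm.trans (Eq.trans ?_ hγ)
    exact congr_arg (HomotopyCategory.quotient _ _).map fac
  · let e := ((BoundedHomotopy.bounded C).ι.commShiftIso (1 : ℤ)).app
        ((BoundedHomotopyCategory.singleFunctor C).obj Y) ≪≫
      (((HomotopyCategory.quotient _ (ComplexShape.up ℤ)).commShiftIso (1 : ℤ)).app
        ((CochainComplex.singleFunctor C 0).obj Y)).symm
    obtain ⟨ψ, hψ⟩ := (HomotopyCategory.quotient _ _).map_surjective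
      ((BoundedHomotopy.bounded C).ι.map φ ≫ e.hom)
    have h₀ : (HomotopyCategory.quotient C (ComplexShape.up ℤ)).map ψ = 0 := by
      refine quotient_map_eq_zero_of_acyclicComplex hL hd (fun n m => ?_) (fun n hn => ?_) ψ
      · rw [CochainComplex.shiftFunctor_obj_d']
        have hz : ((CochainComplex.singleFunctor C 0).obj Y).d (n + 1) (m + 1) = 0 := rfl
        rw [hz, smul_zero]
        rfl
      · exact HomologicalComplex.isZero_single_obj_X (.up ℤ) _ _ _ (by
          intro h; lia)
    apply (BoundedHomotopy.bounded C).ι.map_injective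
    rw [Functor.map_zero]
    refine (cancel_mono e.hom).1 ?_
    exact hψ.symm.trans (h₀.trans zero_comp.symm)

/-- Morphisms in the bounded derived category between objects of the exact category come from
morphisms. -/
instance : E.toDerived.Full where
  map_surjective {X Y} α := by
    obtain ⟨f, hf⟩ := E.acyclic.exists_map_eq_of_factorization
      (fun Z hZ g => exists_factorization_of_acyclic hZ g Y) α
    obtain ⟨f, rfl⟩ := (BoundedHomotopyCategory.singleFunctor C).map_surjective f
    exact ⟨f, hf.symm⟩

end ExactStructure

/-! ### Long exact sequences and vanishing of Ext -/

namespace CategoryTheory.Pretriangulated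

variable {A : Type*} [Category* A]

lemma forall_eq_zero_of_iso [HasZeroMorphisms A] {S T Y Z : A} (e : S ≅ T) (e' : Y ≅ Z)
    (h : ∀ f : S ⟶ Y, f = 0) (f : T ⟶ Z) : f = 0 := by
  rw [← cancel_epi e.hom, ← cancel_mono e'.inv, h ((e.hom ≫ f) ≫ e'.inv), comp_zero, zero_comp]

variable [Preadditive A] [HasZeroObject A] [HasShift A ℤ] [∀ n : ℤ, (shiftFunctor A n).Additive]
  [Pretriangulated A] {X Y Z S : A} {f : X ⟶ Y} {g : Y ⟶ Z} {h : Z ⟶ X⟦(1 : ℤ)⟧}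
  (hT : Triangle.mk f g h ∈ distTriang _)

include hT

/-- A shifted triangle carries the sign `(-1)^n` on all three maps. Rescaling the middle object
removes it from the first two, and the third map is never needed explicitly. -/
lemma exists_distinguished_shift (n : ℤ) :
    ∃ δ : Z⟦n⟧ ⟶ (X⟦n⟧)⟦(1 : ℤ)⟧,
      Triangle.mk (f⟦n⟧') (g⟦n⟧') δ ∈ distTriang _ := by
  have hε : n.negOnePow • n.negOnePow • 𝟙 (Y⟦n⟧) = 𝟙 _ := by
    rw [smul_smul, Int.units_mul_self, one_smul]
  refine ⟨n.negOnePow • (h⟦n⟧' ≫ (shiftFunctorComm A 1 n).hom.app X),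
    isomorphic_distinguished _ (Triangle.shift_distinguished _ hT n) _
      (Triangle.isoMk _ _ (Iso.refl _)
        ⟨n.negOnePow • 𝟙 _, n.negOnePow • 𝟙 _, ?_, ?_⟩ (Iso.refl _) ?_ ?_ ?_)⟩
  · exact (Linear.units_smul_comp _ _ _).trans ((congr_arg _ (Category.id_comp _)).trans hε)
  · exact (Linear.units_smul_comp _ _ _).trans ((congr_arg _ (Category.id_comp _)).trans hε)
  · exact (Linear.comp_units_smul _ _ _).trans
      ((congr_arg _ (Category.comp_id _)).trans (Category.id_comp _).symm)
  · refine (Category.comp_id _).trans (Eq.symm ?_)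
    refine (Linear.units_smul_comp _ _ _).trans ((congr_arg _ (Category.id_comp _)).trans ?_)
    change n.negOnePow • n.negOnePow • g⟦n⟧' = g⟦n⟧'
    rw [smul_smul, Int.units_mul_self, one_smul]
  · refine Eq.trans ?_ (Category.id_comp _).symm
    exact (congr_arg _ (Functor.map_id _ _)).trans (Category.comp_id _)

lemma coyoneda_eq_zero₂ (n : ℤ) (h₁ : ∀ a : S ⟶ X⟦n⟧, a = 0) (h₃ : ∀ a : S ⟶ Z⟦n⟧, a = 0)
    (a : S ⟶ Y⟦n⟧) : a = 0 := by
  obtain ⟨δ, hδ⟩ := exists_distinguished_shift hT n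
  obtain ⟨b, rfl⟩ := Triangle.coyoneda_exact₂ _ hδ a (h₃ _)
  rw [h₁ b]
  exact zero_comp

lemma coyoneda_eq_zero₃ (n m : ℤ) (hm : n + 1 = m) (h₁ : ∀ a : S ⟶ X⟦m⟧, a = 0)
    (h₂ : ∀ a : S ⟶ Y⟦n⟧, a = 0) (a : S ⟶ Z⟦n⟧) : a = 0 := by
  obtain ⟨δ, hδ⟩ := exists_distinguished_shift hT n
  obtain ⟨b, rfl⟩ := Triangle.coyoneda_exact₃ _ hδ a
    (forall_eq_zero_of_iso (Iso.refl _) ((shiftFunctorAdd' A n 1 m hm).app X) h₁ _)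
  rw [h₂ b]
  exact zero_comp

/-- `h₃` asks for lifts instead of vanishing so that `n = 0` is covered, where `Hom(S, Z)` is
nonzero in general but an approximation provides the lifts. -/
lemma coyoneda_eq_zero₁ (n m : ℤ) (hm : n + 1 = m) (h₂ : ∀ a : S ⟶ Y⟦m⟧, a = 0)
    (h₃ : ∀ a : S ⟶ Z⟦n⟧, ∃ b, a = b ≫ g⟦n⟧') (a : S ⟶ X⟦m⟧) : a = 0 := by
  obtain ⟨δ, hδ⟩ := exists_distinguished_shift hT n
  refine forall_eq_zero_of_iso (Iso.refl _) ((shiftFunctorAdd' A n 1 m hm).app X).symm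
    (fun a => ?_) a
  obtain ⟨b, rfl⟩ := Triangle.coyoneda_exact₁ _ hδ a
    (forall_eq_zero_of_iso (Iso.refl _) ((shiftFunctorAdd' A n 1 m hm).app Y) h₂ _)
  obtain ⟨b, rfl⟩ := h₃ b
  refine (Category.assoc _ _ _).trans ((congr_arg _ ?_).trans comp_zero)
  exact comp_distTriang_mor_zero₂₃ _ hδ

lemma yoneda_eq_zero₂ (h₁ : ∀ a : X ⟶ S, a = 0) (h₃ : ∀ a : Z ⟶ S, a = 0) (a : Y ⟶ S) :
    a = 0 := by
  obtain ⟨b, rfl⟩ := Triangle.yoneda_exact₂ _ hT a (h₁ _)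
  rw [h₃ b]
  exact comp_zero

lemma yoneda_eq_zero₃ (n m : ℤ) (hm : n + 1 = m) (h₂ : ∀ a : Y ⟶ S⟦m⟧, a = 0)
    (h₁ : ∀ a : X ⟶ S⟦n⟧, ∃ b, a = f ≫ b) (a : Z ⟶ S⟦m⟧) : a = 0 := by
  refine forall_eq_zero_of_iso (Iso.refl _) ((shiftFunctorAdd' A n 1 m hm).app S).symm
    (fun a => ?_) a
  obtain ⟨b, rfl⟩ := Triangle.yoneda_exact₃ _ hT a
    (forall_eq_zero_of_iso (Iso.refl _) ((shiftFunctorAdd' A n 1 m hm).app S) h₂ _)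
  obtain ⟨b, rfl⟩ := (shiftFunctor A (1 : ℤ)).map_surjective b
  obtain ⟨b, rfl⟩ := h₁ b
  refine (congr_arg (h ≫ ·) (Functor.map_comp _ _ _)).trans ?_
  refine (Category.assoc _ _ _).symm.trans ((congr_arg (· ≫ _) ?_).trans zero_comp)
  exact comp_distTriang_mor_zero₃₁ _ hT

end CategoryTheory.Pretriangulated

namespace ExactStructure

variable {C : Type u} [Category.{v} C] [Preadditive C] {E : ExactStructure C} [HasZeroObject C]
  [HasBinaryBiproducts C]

lemma extVanishes_iff {X Y : C} {n : ℕ} {m : ℤ} (hm : n = m) : E.ExtVanishes X Y n ↔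
    ∀ f : E.toDerived.obj X ⟶ (E.toDerived.obj Y)⟦m⟧, f = 0 := by
  subst hm
  let e := (E.acyclic.trW.Q.commShiftIso (n : ℤ)).app (BoundedHomotopyCategory.single Y)
  have h : E.ExtVanishes X Y n ↔
    ∀ f : E.toDerived.obj X ⟶ E.acyclic.trW.Q.obj ((BoundedHomotopyCategory.single Y)⟦(n : ℤ)⟧),
      f = 0 := ⟨fun h f => h.elim _ _, fun h => ⟨fun f g => (h f).trans (h g).symm⟩⟩
  rw [h]
  exact ⟨forall_eq_zero_of_iso (Iso.refl _) e, forall_eq_zero_of_iso (Iso.refl _) e.symm⟩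

lemma extVanishes_of_isZero_left {X : C} (hX : IsZero X) (Y : C) (n : ℕ) : E.ExtVanishes X Y n :=
  (extVanishes_iff rfl).2 fun _ => (E.toDerived.map_isZero hX).eq_of_src _ _

lemma extVanishes_of_isZero_right (X : C) {Y : C} (hY : IsZero Y) (n : ℕ) : E.ExtVanishes X Y n :=
  (extVanishes_iff rfl).2 fun _ =>
    ((shiftFunctor _ (n : ℤ)).map_isZero (E.toDerived.map_isZero hY)).eq_of_tgt _ _

namespace IsConflation

variable {X Y Z S : C} {i : X ⟶ Y} {p : Y ⟶ Z} (h : E.IsConflation i p) {n : ℕ}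

include h

lemma extVanishes_to₂ (hX : E.ExtVanishes S X n) (hZ : E.ExtVanishes S Z n) :
    E.ExtVanishes S Y n := by
  obtain ⟨δ, hδ⟩ := h.exists_distinguished
  rw [extVanishes_iff rfl] at hX hZ ⊢
  exact coyoneda_eq_zero₂ hδ _ hX hZ

lemma extVanishes_to₃ (hX : E.ExtVanishes S X (n + 1)) (hY : E.ExtVanishes S Y n) :
    E.ExtVanishes S Z n := by
  obtain ⟨δ, hδ⟩ := h.exists_distinguished
  rw [extVanishes_iff rfl] at hX hY ⊢
  exact coyoneda_eq_zero₃ hδ n _ (Nat.cast_succ n).symm hX hY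

lemma extVanishes_to₁ (hY : E.ExtVanishes S Y (n + 1)) (hZ : E.ExtVanishes S Z n) :
    E.ExtVanishes S X (n + 1) := by
  obtain ⟨δ, hδ⟩ := h.exists_distinguished
  rw [extVanishes_iff rfl] at hY hZ ⊢
  exact coyoneda_eq_zero₁ hδ n _ (Nat.cast_succ n).symm hY
    fun a => ⟨0, (hZ a).trans zero_comp.symm⟩

lemma extVanishes_to₁_one (hY : E.ExtVanishes S Y 1) (hp : ∀ a : S ⟶ Z, ∃ b, b ≫ p = a) :
    E.ExtVanishes S X 1 := by
  obtain ⟨δ, hδ⟩ := h.exists_distinguished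
  rw [extVanishes_iff Nat.cast_one] at hY ⊢
  refine coyoneda_eq_zero₁ hδ 0 _ (zero_add 1) hY fun a => ?_
  -- By fullness, a morphism in degree `0` of the derived category comes from `C`, where `hp` lifts
  -- it.
  obtain ⟨a', ha'⟩ := E.toDerived.map_surjective (a ≫ (shiftFunctorZero _ ℤ).hom.app _)
  obtain ⟨b, rfl⟩ := hp a'
  refine ⟨E.toDerived.map b ≫ (shiftFunctorZero _ ℤ).inv.app (E.toDerived.obj _), ?_⟩
  rw [← cancel_mono ((shiftFunctorZero _ ℤ).hom.app _), ← ha', Functor.map_comp]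
  simp

lemma extVanishes_from₂ (hX : E.ExtVanishes X S n) (hZ : E.ExtVanishes Z S n) :
    E.ExtVanishes Y S n := by
  obtain ⟨δ, hδ⟩ := h.exists_distinguished
  rw [extVanishes_iff rfl] at hX hZ ⊢
  exact yoneda_eq_zero₂ hδ hX hZ

lemma extVanishes_from₃ (hY : E.ExtVanishes Y S (n + 1)) (hX : E.ExtVanishes X S n) :
    E.ExtVanishes Z S (n + 1) := by
  obtain ⟨δ, hδ⟩ := h.exists_distinguished
  rw [extVanishes_iff rfl] at hX hY ⊢
  exact yoneda_eq_zero₃ hδ n _ (Nat.cast_succ n).symm hY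
    fun a => ⟨0, (hX a).trans comp_zero.symm⟩

lemma extVanishes_from₃_one (hY : E.ExtVanishes Y S 1) (hi : ∀ a : X ⟶ S, ∃ b, i ≫ b = a) :
    E.ExtVanishes Z S 1 := by
  obtain ⟨δ, hδ⟩ := h.exists_distinguished
  rw [extVanishes_iff Nat.cast_one] at hY ⊢
  refine yoneda_eq_zero₃ hδ 0 _ (zero_add 1) hY fun a => ?_
  obtain ⟨a', ha'⟩ := E.toDerived.map_surjective (a ≫ (shiftFunctorZero _ ℤ).hom.app _)
  obtain ⟨b, rfl⟩ := hi a'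
  refine ⟨E.toDerived.map b ≫ (shiftFunctorZero _ ℤ).inv.app (E.toDerived.obj _), ?_⟩
  rw [← cancel_mono ((shiftFunctorZero _ ℤ).hom.app _), ← ha', Functor.map_comp]
  simp

end IsConflation

end ExactStructure

/-! ### Cluster tilting: dimension shifting and the two inductions -/

namespace ExactStructure

variable {C : Type u} [Category.{v} C] [Preadditive C] {E : ExactStructure C} [HasZeroObject C]
  [HasBinaryBiproducts C] {M : ObjectProperty C}

lemma ExtFromVanishes.mono {X : C} {m n : ℕ} (h : E.ExtFromVanishes M n X) (hmn : m ≤ n) :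
    E.ExtFromVanishes M m X :=
  fun j hj hj' => h j hj (hj'.trans_le hmn)

lemma ExtToVanishes.mono {X : C} {m n : ℕ} (h : E.ExtToVanishes M n X) (hmn : m ≤ n) :
    E.ExtToVanishes M m X :=
  fun j hj hj' => h j hj (hj'.trans_le hmn)

namespace IsConflation

variable {X Y Z : C} {i : X ⟶ Y} {p : Y ⟶ Z} (h : E.IsConflation i p) {n : ℕ}

include h

lemma extFromVanishes₂ (hX : E.ExtFromVanishes M n X) (hZ : E.ExtFromVanishes M n Z) :
    E.ExtFromVanishes M n Y :=
  fun j hj hj' S hS => h.extVanishes_to₂ (hX j hj hj' S hS) (hZ j hj hj' S hS)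

lemma extFromVanishes₃ (hX : E.ExtFromVanishes M (n + 1) X) (hY : E.ExtFromVanishes M n Y) :
    E.ExtFromVanishes M n Z :=
  fun j hj hj' S hS => h.extVanishes_to₃ (hX (j + 1) (by lia) (by lia) S hS) (hY j hj hj' S hS)

/-- Degrees above `1` are plain dimension shifting; degree `1` uses that `p` is surjective on
morphisms from `M`. -/
lemma extFromVanishes₁ (hY : E.ExtFromVanishes M (n + 1) Y) (hZ : E.ExtFromVanishes M n Z)
    (hp : ∀ S : C, M S → ∀ a : S ⟶ Z, ∃ b, b ≫ p = a) : E.ExtFromVanishes M (n + 1) X := by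
  rintro j hj hj' S hS
  obtain _ | _ | j := j
  · lia
  · exact h.extVanishes_to₁_one (hY 1 hj hj' S hS) (hp S hS)
  · exact h.extVanishes_to₁ (hY _ hj hj' S hS) (hZ _ (by lia) (by lia) S hS)

lemma extToVanishes₂ (hX : E.ExtToVanishes M n X) (hZ : E.ExtToVanishes M n Z) :
    E.ExtToVanishes M n Y :=
  fun j hj hj' S hS => h.extVanishes_from₂ (hX j hj hj' S hS) (hZ j hj hj' S hS)

lemma extToVanishes₃ (hY : E.ExtToVanishes M (n + 1) Y) (hX : E.ExtToVanishes M n X)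
    (hi : ∀ S : C, M S → ∀ a : X ⟶ S, ∃ b, i ≫ b = a) : E.ExtToVanishes M (n + 1) Z := by
  rintro j hj hj' S hS
  obtain _ | _ | j := j
  · lia
  · exact h.extVanishes_from₃_one (hY 1 hj hj' S hS) (hi S hS)
  · exact h.extVanishes_from₃ (hY _ hj hj' S hS) (hX _ (by lia) (by lia) S hS)

end IsConflation

lemma extVanishing_of_isZero {X : C} (hX : IsZero X) (m n : ℕ) : E.extVanishing M m n X :=
  ⟨fun _ _ _ _ _ => extVanishes_of_isZero_left hX _ _,
    fun _ _ _ _ _ => extVanishes_of_isZero_right _ hX _⟩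

namespace IsClusterTilting

variable {d : ℕ} (hM : E.IsClusterTilting d M)

include hM

lemma mem_of_isZero {X : C} (hX : IsZero X) : M X :=
  (hM.mem_iff_extTo X).2 (extVanishing_of_isZero hX d d).1

lemma biprod_mem {X Y : C} (hX : M X) (hY : M Y) : M (X ⊞ Y) :=
  (hM.mem_iff_extTo _).2 ((E.isConflation_inl_snd X Y).extToVanishes₂
    ((hM.mem_iff_extTo X).1 hX) ((hM.mem_iff_extTo Y).1 hY))

lemma exists_right_approximation (X : C) :
    ∃ (K N : C) (i : K ⟶ N) (p : N ⟶ X), E.IsConflation i p ∧ IsRightApproximation M p := by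
  obtain ⟨N, f, hN, hf⟩ := hM.contravariantlyFinite X
  obtain ⟨N', p, hN', hp⟩ := hM.generating X
  obtain ⟨K, i, h⟩ := exists_isConflation_of_deflation (deflation_biprod_desc hp f)
  refine ⟨K, _, i, _, h, hM.biprod_mem hN hN', fun S hS a => ?_⟩
  obtain ⟨b, rfl⟩ := hf S hS a
  exact ⟨b ≫ biprod.inl, by simp⟩

lemma exists_left_approximation (X : C) :
    ∃ (N Z : C) (i : X ⟶ N) (p : N ⟶ Z), E.IsConflation i p ∧ IsLeftApproximation M i := by
  obtain ⟨N, f, hN, hf⟩ := hM.covariantlyFinite X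
  obtain ⟨N', i, hN', hi⟩ := hM.cogenerating X
  obtain ⟨Z, p, h⟩ := exists_isConflation_of_inflation (inflation_biprod_lift hi f)
  refine ⟨_, Z, _, p, h, hM.biprod_mem hN' hN, fun S hS a => ?_⟩
  obtain ⟨b, rfl⟩ := hf S hS a
  exact ⟨biprod.snd ≫ b, by simp⟩

/-- An object `X` with `Ext^j(M, X) = 0` for `0 < j < n` is the cokernel of an inflation `K ⟶ L`
with `Ext^i(L, M) = 0` for `0 < i < d - n` and `Ext^j(M, K) = 0` for `0 < j < n + 2`. -/
lemma exists_isConflation_extVanishing {m n : ℕ} (hm : 0 < m) (hn : 0 < n) (hmn : m + n = d) {X : C}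
    (hX : E.ExtFromVanishes M n X) :
    ∃ (K L : C) (i : K ⟶ L) (p : L ⟶ X), E.IsConflation i p ∧
      E.ExtToVanishes M m L ∧ E.ExtFromVanishes M (n + 2) K := by
  obtain ⟨m, rfl⟩ : ∃ k, m = k + 1 := ⟨m - 1, by lia⟩
  induction m generalizing n X with
  | zero =>
    -- For `m = 1` nothing is asked of `L`, so `K = 0` and `L = X` suffice.
    exact ⟨_, X, 0, 𝟙 X, E.isConflation_of_isZero_id X (isZero_zero C) 0,
      fun j hj hj' => by lia, (extVanishing_of_isZero (isZero_zero C) 0 _).2⟩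
  | succ m ih =>
    obtain ⟨K₁, N₀, i₀, p₀, h₀, hN₀, hp₀⟩ := hM.exists_right_approximation X
    have hK₁ : E.ExtFromVanishes M (n + 1) K₁ := h₀.extFromVanishes₁
      (((hM.mem_iff_extFrom N₀).1 hN₀).mono (by lia)) hX hp₀
    -- The syzygy `K₁` has gained one degree of vanishing, so the induction applies with `m` lowered
    -- and `n` raised by one.
    obtain ⟨K, L, k, q, h, hL, hK⟩ := ih (by lia) hK₁ (by lia) (by lia)
    obtain ⟨N, L₁, i₁, p₁, h₁, hN, hi₁⟩ := hM.exists_left_approximation L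
    have hL₁ : E.ExtToVanishes M (m + 2) L₁ := h₁.extToVanishes₃
      (((hM.mem_iff_extTo N).1 hN).mono (by lia)) hL hi₁
    -- Passing to the cosyzygy `L₁` of `L` restores the degree lost in `m`. The conflation `K → L →
    -- K₁` becomes `K₁ → P → L₁`, where `P` is a cosyzygy of `K`.
    obtain ⟨P, π, e, r, -, hP, he, -⟩ := h.exists_cokernel_comp h₁
    have hP' : E.ExtFromVanishes M (n + 2) P := hP.extFromVanishes₃ hK
      (((hM.mem_iff_extFrom N).1 hN).mono (by lia))
    -- Pushing out `K₁ → P` along `K₁ → N₀` gives `N₀ → R → L₁` and `P → R → X`: the first controls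
    -- `Ext^i(R, M)`, the second is the desired conflation.
    obtain ⟨R, a, b, c, f, hR, hR'⟩ := he.exists_of_common_source h₀
    exact ⟨P, R, _, _, hR', hR.extToVanishes₂ (((hM.mem_iff_extTo N₀).1 hN₀).mono (by lia)) hL₁,
      hP'⟩

lemma exists_filtered_biprod {m n : ℕ} (hm : 0 < m) (hn : 0 < n) (hmn : m + n = d) {X : C}
    (hX : E.ExtFromVanishes M n X) :
    ∃ N : C, M N ∧
      E.Filtered (fun Y => ∃ m n : ℕ, 0 < m ∧ 0 < n ∧ m + n = d ∧ E.extVanishing M m n Y)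
        (X ⊞ N) := by
  obtain ⟨m, rfl⟩ : ∃ k, m = k + 1 := ⟨m - 1, by lia⟩
  induction m generalizing n X with
  | zero =>
    refine ⟨_, hM.mem_of_isZero (isZero_zero C), ?_⟩
    -- For `m = 1` the object `X` itself lies in `E_{1,n}` and forms a single layer.
    refine Filtered.of_iso (isoBiprodZero (isZero_zero C)) (Filtered.of_prop
      ⟨1, n, one_pos, hn, by lia, fun j hj hj' => by lia, hX⟩)
  | succ m ih =>
    obtain ⟨K, L, k, q, h, hL, hK⟩ := hM.exists_isConflation_extVanishing hm hn hmn hX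
    obtain ⟨N, L₁, i₁, p₁, h₁, hN, hi₁⟩ := hM.exists_left_approximation L
    obtain ⟨W, π, e, r, s, hW, -, hs⟩ := h.exists_cokernel_comp h₁
    have hW' : E.ExtFromVanishes M (n + 1) W := hW.extFromVanishes₃ hK
      (((hM.mem_iff_extFrom N).1 hN).mono (by lia))
    obtain ⟨N', hN', hF⟩ := ih (by lia) hW' (by lia) (by lia)
    -- The new bottom layer is `L`, through `L → (X ⊞ N) ⊞ N' → W ⊞ N'`.
    refine ⟨N ⊞ N', hM.biprod_mem hN hN', Filtered.of_iso (biprod.associator X N N')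
      (hF.of_isConflation (hs.biprod_map_id N')
        ⟨m + 1 + 1, n, by lia, hn, hmn, hL, h.extFromVanishes₂ (hK.mono (by lia)) hX⟩)⟩

end IsClusterTilting

end ExactStructure

theorem lemma6p6 {C : Type u} [Category.{v} C] [Preadditive C] [HasZeroObject C]
    [HasBinaryBiproducts C] (E : ExactStructure C) (hC : IsWeaklyIdempotentComplete C)
    (d : ℕ) (hd : 2 ≤ d) (M : ObjectProperty C) (hM : E.IsClusterTilting d M) (X : C) :
    ∃ N : C, M N ∧
      E.Filt (fun Y => ∃ m n : ℕ, 0 < m ∧ 0 < n ∧ m + n = d ∧ E.extVanishing M m n Y) (X ⊞ N) := by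
  -- With `n = 1` the vanishing condition on `X` is empty.
  obtain ⟨N, hN, h⟩ := hM.exists_filtered_biprod (m := d - 1) (n := 1) (by lia) one_pos (by lia)
    (X := X) fun j hj hj' => by lia
  exact ⟨N, hN, h.filt fun Y hY => ⟨d - 1, 1, by lia, one_pos, by lia,
    ExactStructure.extVanishing_of_isZero hY _ _⟩⟩
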